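/- Let $r>0$ and $\epsilon\in\{1,-1\}$. On $\mathbb{C}^3$ consider the Hermitian form $\langle z,w\rangle=\epsilon z_0\bar w_0+z_1\bar w_1+z_2\bar w_2$, let $Q=\{z\in\mathbb{C}^3:\langle z,z\rangle=\epsilon r^2\}$ and let $X=Q/S^1$, with the metric induced from the orthogonal complement of the fibres of $Q\to X$ and its complex structure $J$. Thus $X$ is $\mathbb{CP}^2$ (for $\epsilon=1$) or $\mathbb{CH}^2$ (for $\epsilon=-1$) with constant holomorphic sectional curvature $4\epsilon/r^2$. Let $\Phi:M^3\to X$ be a smooth (immersed) hypersurface with local unit normal field $\xi$, structure vector field $W=-J\xi$ and shape operator $Av=-\widetilde\nabla_v\xi$, where $\widetilde\nabla$ is the Levi-Civita connection of $X$. Let $\mathcal{H}$ be the distribution on $M$ with $\mathcal{H}_p=\operatorname{span}\{W,AW,A^2W,\dots\}$ at each $p\in M$; it does not depend on the choice of the sign of $\xi$. Suppose that $M$ is 2-Hopf, i.e. that $\mathcal{H}$ has rank $2$ at every point and is integrable (through every point of $M$ there passes a $2$-dimensional integral manifold of $\mathcal{H}$). Then the leaves of $\mathcal{H}$ are flat: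 every immersed integral surface $j:S^2\to M$ of $\mathcal{H}$ (so, in particular, every leaf), with the Riemannian metric induced from $X$ by $\Phi\circ j$, has Gauss curvature zero at every point. -/

import Mathlib

open scoped Manifold ContDiff LinearAlgebra.Projectivization

namespace TwoHopf

/-! ### Riemannian geometry

A (possibly indefinite or degenerate) metric on a manifold `X` is a family of continuous bilinear
forms on its tangent spaces.  The tangent space of Mathlib at `q` is the model vector space, seen
through the preferred chart at `q`. -/

section Riemannian

variable {E : Type*} [NormedAddCommGroup E] [NormedSpace ℝ E]
  {E' : Type*} [NormedAddCommGroup E'] [NormedSpace ℝ E']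

/-- A field of bilinear forms on the tangent spaces of `X`. -/
abbrev Metric (E : Type*) [NormedAddCommGroup E] [NormedSpace ℝ E]
    (X : Type*) [TopologicalSpace X] [ChartedSpace E X] : Type _ :=
  ∀ q : X, TangentSpace 𝓘(ℝ, E) q →L[ℝ] TangentSpace 𝓘(ℝ, E) q →L[ℝ] ℝ

/-- The pullback `f^* g`; for an immersion `f`, the induced metric (first fundamental form). -/
noncomputable def pullbackMetric
    {M : Type*} [TopologicalSpace M] [ChartedSpace E M]
    {X : Type*} [TopologicalSpace X] [ChartedSpace E' X]
    (f : M → X) (g : Metric E' X) : Metric E M :=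
  fun p =>
    let G : E' →L[ℝ] E' →L[ℝ] ℝ := g (f p)
    let T : E →L[ℝ] E' := mfderiv 𝓘(ℝ, E) 𝓘(ℝ, E') f p
    let B : E →L[ℝ] E →L[ℝ] ℝ := G.bilinearComp T T
    B

/-- The coefficients of the metric `g` in the preferred chart at `q`: a field of bilinear forms on
the model space. -/
noncomputable def metricInChart
    {X : Type*} [TopologicalSpace X] [ChartedSpace E X] (g : Metric E X) (q : X) :
    E → E →L[ℝ] E →L[ℝ] ℝ :=
  pullbackMetric (extChartAt 𝓘(ℝ, E) q).symm g

/-- Christoffel symbols of the first kind of a metric `G` on (an open subset of) a vector space: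
`w ↦ ½ (∂_u G(v, w) + ∂_v G(u, w) - ∂_w G(u, v))`. -/
noncomputable def christoffelLower (G : E → E →L[ℝ] E →L[ℝ] ℝ) (x u v : E) : E →L[ℝ] ℝ :=
  (1 / 2 : ℝ) • (fderiv ℝ G x u v + fderiv ℝ G x v u - ((fderiv ℝ G x).flip u).flip v)

/-- Christoffel symbols of the second kind: the vector `Γ` with
`G(Γ, w) = ½ (∂_u G(v, w) + ∂_v G(u, w) - ∂_w G(u, v))` for all `w`. -/
noncomputable def christoffel (G : E → E →L[ℝ] E →L[ℝ] ℝ) (x u v : E) : E :=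
  (G x).inverse (christoffelLower G x u v)

/-- The curvature `R(u, v) w` at `x` of the Levi-Civita connection of `G`, for constant fields
`u, v, w`. -/
noncomputable def curvature (G : E → E →L[ℝ] E →L[ℝ] ℝ) (x u v w : E) : E :=
  fderiv ℝ (fun y => christoffel G y v w) x u - fderiv ℝ (fun y => christoffel G y u w) x v
    + christoffel G x u (christoffel G x v w) - christoffel G x v (christoffel G x u w)

/-- The Gauss curvature `⟨R(e₁, e₂) e₂, e₁⟩ / (|e₁|² |e₂|² - ⟨e₁, e₂⟩²)` of a metric on a surface,
computed in the preferred chart at `s`. -/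
noncomputable def gaussCurvature
    {S : Type*} [TopologicalSpace S] [ChartedSpace (EuclideanSpace ℝ (Fin 2)) S]
    (h : Metric (EuclideanSpace ℝ (Fin 2)) S) (s : S) : ℝ :=
  let G := metricInChart h s
  let x := extChartAt (𝓡 2) s s
  let e₁ : EuclideanSpace ℝ (Fin 2) := EuclideanSpace.single 0 1
  let e₂ : EuclideanSpace ℝ (Fin 2) := EuclideanSpace.single 1 1
  G x (curvature G x e₁ e₂ e₂) e₁ / (G x e₁ e₁ * G x e₂ e₂ - G x e₁ e₂ ^ 2)

/-- The Levi-Civita covariant derivative `∇_v ξ` in `(X, g)` of a vector field `ξ` along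
`Φ : M → X`, in the direction `v ∈ T_p M`: in the preferred chart at `Φ p` it is
`dξ(v) + Γ(dΦ(v), ξ)`. -/
noncomputable def covDerivAlong
    {M : Type*} [TopologicalSpace M] [ChartedSpace E M]
    {X : Type*} [TopologicalSpace X] [ChartedSpace E' X] [IsManifold 𝓘(ℝ, E') ∞ X]
    (g : Metric E' X) (Φ : M → X) (ξ : ∀ p, TangentSpace 𝓘(ℝ, E') (Φ p))
    (p : M) (v : TangentSpace 𝓘(ℝ, E) p) : TangentSpace 𝓘(ℝ, E') (Φ p) :=
  haveI : IsManifold 𝓘(ℝ, E') 1 X := IsManifold.of_le (n := ∞) (by simp)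
  let ξ' : M → E' := fun p' =>
    (trivializationAt E' (TangentSpace 𝓘(ℝ, E')) (Φ p) ⟨Φ p', ξ p'⟩).2
  let dξ : E' := mfderiv 𝓘(ℝ, E) 𝓘(ℝ, E') ξ' p v
  let dΦv : E' := mfderiv 𝓘(ℝ, E) 𝓘(ℝ, E') Φ p v
  dξ + christoffel (metricInChart g (Φ p)) (extChartAt 𝓘(ℝ, E') (Φ p) (Φ p)) dΦv (ξ p)

/-- Smooth immersions. -/
def IsSmoothImmersion
    {M : Type*} [TopologicalSpace M] [ChartedSpace E M]
    {X : Type*} [TopologicalSpace X] [ChartedSpace E' X] (f : M → X) : Prop :=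
  ContMDiff 𝓘(ℝ, E) 𝓘(ℝ, E') ∞ f ∧
    ∀ p, Function.Injective (mfderiv 𝓘(ℝ, E) 𝓘(ℝ, E') f p)

/-- `j : S → M` is an immersed integral manifold of the distribution `D` on `M`: an immersion whose
tangent spaces are those of `D`. -/
def IsIntegralManifold
    {S : Type*} [TopologicalSpace S] [ChartedSpace E S]
    {M : Type*} [TopologicalSpace M] [ChartedSpace E' M]
    (D : ∀ p : M, Submodule ℝ (TangentSpace 𝓘(ℝ, E') p)) (j : S → M) : Prop :=
  IsSmoothImmersion (E := E) (E' := E') j ∧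
    ∀ s, (mfderiv 𝓘(ℝ, E) 𝓘(ℝ, E') j s).range = D (j s)

/-- A distribution `D` of rank `k` is integrable if an integral manifold of dimension `k` passes
through every point. -/
def IsIntegrable
    {M : Type*} [TopologicalSpace M] [ChartedSpace E M] (k : ℕ)
    (D : ∀ p : M, Submodule ℝ (TangentSpace 𝓘(ℝ, E) p)) : Prop :=
  ∀ p : M, ∃ (U : TopologicalSpace.Opens (EuclideanSpace ℝ (Fin k))) (j : U → M),
    IsIntegralManifold (E := EuclideanSpace ℝ (Fin k)) D j ∧ p ∈ Set.range j

end Riemannian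

/-! ### The complex space forms `ℂP²` and `ℂH²` -/

section SpaceForm

/-- The Hermitian form on `ℂ³` of signature `+++` (for `ε = 1`) or `-++` (for `ε = -1`). -/
noncomputable def herm (ε : ℤˣ) (z w : Fin 3 → ℂ) : ℂ :=
  ((ε : ℤ) : ℂ) * (z 0 * star (w 0)) + z 1 * star (w 1) + z 2 * star (w 2)

/-- `ε ⟨z, z⟩ > 0`, so that `z` has a multiple on the quadric `⟨z, z⟩ = ε r²`. -/
def IsAdmissible (ε : ℤˣ) (z : Fin 3 → ℂ) : Prop := 0 < ((ε : ℤ) : ℝ) * (herm ε z z).re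

/-- The complex projective plane (`ε = 1`) or the complex hyperbolic plane (`ε = -1`), as the set of
complex lines in `ℂ³` that meet the quadric `⟨z, z⟩ = ε r²`. -/
def SpaceForm (ε : ℤˣ) : Type := {L : ℙ ℂ (Fin 3 → ℂ) // IsAdmissible ε L.rep}

lemma herm_smul_self (ε : ℤˣ) (a : ℂ) (z : Fin 3 → ℂ) :
    (herm ε (a • z) (a • z)).re = Complex.normSq a * (herm ε z z).re := by
  have : herm ε (a • z) (a • z) = (Complex.normSq a : ℂ) * herm ε z z := by
    rw [← Complex.mul_conj]
    simp only [herm, Pi.smul_apply, smul_eq_mul, star_mul', Complex.star_def]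
    ring
  rw [this, Complex.re_ofReal_mul]

lemma isAdmissible_smul {ε : ℤˣ} {a : ℂ} (ha : a ≠ 0) {z : Fin 3 → ℂ} :
    IsAdmissible ε (a • z) ↔ IsAdmissible ε z := by
  have h : 0 < Complex.normSq a := Complex.normSq_pos.2 ha
  unfold IsAdmissible
  rw [herm_smul_self, mul_left_comm]
  exact mul_pos_iff_of_pos_left h

lemma IsAdmissible.ne_zero {ε : ℤˣ} {z : Fin 3 → ℂ} (h : IsAdmissible ε z) : z ≠ 0 := by
  rintro rfl
  simp [IsAdmissible, herm] at h

lemma exists_rep_mk (z : Fin 3 → ℂ) (hz : z ≠ 0) :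
    ∃ a : ℂ, a ≠ 0 ∧ (Projectivization.mk ℂ z hz).rep = a • z := by
  obtain ⟨a, ha⟩ := Projectivization.exists_smul_eq_mk_rep ℂ z hz
  exact ⟨a, a.ne_zero, ha.symm⟩

/-- The line spanned by an admissible vector. -/
noncomputable def SpaceForm.mk {ε : ℤˣ} (z : Fin 3 → ℂ) (hz : IsAdmissible ε z) : SpaceForm ε :=
  ⟨Projectivization.mk ℂ z hz.ne_zero, by
    obtain ⟨a, ha, h⟩ := exists_rep_mk z hz.ne_zero
    rw [h]
    exact (isAdmissible_smul ha).2 hz⟩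

lemma isAdmissible_single (ε : ℤˣ) : IsAdmissible ε (Pi.single 0 1) := by
  rcases Int.units_eq_one_or ε with h | h <;> simp [IsAdmissible, herm, h]

/-- The vector of `ℂ³` with `i`-th coordinate `a` and the other two coordinates given by `w`. -/
def homog (i : Fin 3) (a : ℂ) (w : Fin 2 → ℂ) : Fin 3 → ℂ :=
  Fin.insertNth (α := fun _ => ℂ) i a w

@[simp] lemma homog_same (i : Fin 3) (a : ℂ) (w : Fin 2 → ℂ) : homog i a w i = a := by
  simp [homog]

@[simp] lemma homog_succAbove (i : Fin 3) (a : ℂ) (w : Fin 2 → ℂ) (k : Fin 2) :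
    homog i a w (i.succAbove k) = w k := by
  simp [homog]

lemma homog_quot (i : Fin 3) (z : Fin 3 → ℂ) (hz : z i ≠ 0) :
    homog i 1 (fun k => z (i.succAbove k) / z i) = (z i)⁻¹ • z := by
  funext l
  rcases Fin.eq_self_or_eq_succAbove i l with rfl | ⟨k, rfl⟩
  · simp [hz]
  · simp [div_eq_inv_mul]

open Classical in
/-- The affine chart `[z] ↦ (z_k / z_i)_{k ≠ i}`, defined where `z_i ≠ 0`. -/
noncomputable def affineChart (ε : ℤˣ) (i : Fin 3) : PartialEquiv (SpaceForm ε) (Fin 2 → ℂ) where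
  toFun L := fun k => L.1.rep (i.succAbove k) / L.1.rep i
  invFun w := if h : IsAdmissible ε (homog i 1 w) then SpaceForm.mk _ h
    else SpaceForm.mk _ (isAdmissible_single ε)
  source := {L | L.1.rep i ≠ 0}
  target := {w | IsAdmissible ε (homog i 1 w)}
  map_source' L hL := by
    have hL' : L.1.rep i ≠ 0 := hL
    change IsAdmissible ε _
    rw [homog_quot i _ hL', isAdmissible_smul (inv_ne_zero hL')]
    exact L.2
  map_target' w hw := by
    have hw' : IsAdmissible ε (homog i 1 w) := hw
    obtain ⟨a, ha, h⟩ := exists_rep_mk (homog i 1 w) hw'.ne_zero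
    change (dite _ _ _ : SpaceForm ε).1.rep i ≠ 0
    rw [dif_pos hw']
    simp [SpaceForm.mk, h, ha]
  left_inv' L hL := by
    have hL' : L.1.rep i ≠ 0 := hL
    have hadm : IsAdmissible ε (homog i 1 fun k => L.1.rep (i.succAbove k) / L.1.rep i) := by
      rw [homog_quot i _ hL', isAdmissible_smul (inv_ne_zero hL')]
      exact L.2
    rw [dif_pos hadm]
    apply Subtype.ext
    conv_rhs => rw [← L.1.mk_rep]
    simp only [SpaceForm.mk]
    rw [Projectivization.mk_eq_mk_iff']
    exact ⟨(L.1.rep i)⁻¹, (homog_quot i _ hL').symm⟩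
  right_inv' w hw := by
    have hw' : IsAdmissible ε (homog i 1 w) := hw
    obtain ⟨a, ha, h⟩ := exists_rep_mk (homog i 1 w) hw'.ne_zero
    rw [dif_pos hw']
    funext k
    simp [SpaceForm.mk, h, ha]

lemma exists_rep_ne_zero {ε : ℤˣ} (L : SpaceForm ε) : ∃ i, L.1.rep i ≠ 0 :=
  Function.ne_iff.1 L.2.ne_zero

/-- The index of the preferred affine chart at `L`. -/
noncomputable def chartIndex {ε : ℤˣ} (L : SpaceForm ε) : Fin 3 := (exists_rep_ne_zero L).choose

lemma chartIndex_spec {ε : ℤˣ} (L : SpaceForm ε) : L.1.rep (chartIndex L) ≠ 0 :=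
  (exists_rep_ne_zero L).choose_spec

lemma affineChart_symm_rep {ε : ℤˣ} (i : Fin 3) {w : Fin 2 → ℂ} (hw : IsAdmissible ε (homog i 1 w)) :
    ∃ a : ℂ, a ≠ 0 ∧ ((affineChart ε i).symm w).1.rep = a • homog i 1 w := by
  obtain ⟨a, ha, h⟩ := exists_rep_mk (homog i 1 w) hw.ne_zero
  refine ⟨a, ha, ?_⟩
  rw [← h]
  simp [affineChart, hw, SpaceForm.mk]

lemma transition_source (ε : ℤˣ) (i j : Fin 3) :
    ((affineChart ε i).symm.trans (affineChart ε j)).source =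
      {w | IsAdmissible ε (homog i 1 w) ∧ homog i 1 w j ≠ 0} := by
  ext w
  rw [PartialEquiv.trans_source]
  constructor
  · rintro ⟨h1, h2⟩
    have h1' : IsAdmissible ε (homog i 1 w) := h1
    have h2' : ((affineChart ε i).symm w).1.rep j ≠ 0 := h2
    obtain ⟨a, ha, h⟩ := affineChart_symm_rep i h1'
    rw [h] at h2'
    exact ⟨h1', fun h0 => h2' (by simp [h0])⟩
  · rintro ⟨h1, h2⟩
    refine ⟨h1, ?_⟩
    change ((affineChart ε i).symm w).1.rep j ≠ 0
    obtain ⟨a, ha, h⟩ := affineChart_symm_rep i h1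
    rw [h]
    simp [ha, h2]

lemma transition_apply (ε : ℤˣ) (i j : Fin 3) {w : Fin 2 → ℂ}
    (hw : IsAdmissible ε (homog i 1 w)) :
    ((affineChart ε i).symm.trans (affineChart ε j)) w =
      fun k => homog i 1 w (j.succAbove k) / homog i 1 w j := by
  obtain ⟨a, ha, h⟩ := affineChart_symm_rep i hw
  funext k
  change ((affineChart ε i).symm w).1.rep _ / ((affineChart ε i).symm w).1.rep j = _
  rw [h]
  simp [mul_div_mul_left _ _ ha]

lemma contDiff_homog (i l : Fin 3) : ContDiff ℝ ∞ (fun w : Fin 2 → ℂ => homog i 1 w l) := by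
  rcases Fin.eq_self_or_eq_succAbove i l with rfl | ⟨k, rfl⟩
  · simpa using contDiff_const
  · simpa using contDiff_apply ℝ ℂ k

lemma isOpen_transition_source (ε : ℤˣ) (i j : Fin 3) :
    IsOpen ((affineChart ε i).symm.trans (affineChart ε j)).source := by
  rw [transition_source]
  have hc : ∀ l, Continuous (fun w : Fin 2 → ℂ => homog i 1 w l) :=
    fun l => (contDiff_homog i l).continuous
  refine IsOpen.and ?_ (isOpen_ne_fun (hc j) continuous_const)
  unfold IsAdmissible
  refine isOpen_lt continuous_const ?_
  unfold herm
  have h0 := hc 0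
  have h1 := hc 1
  have h2 := hc 2
  fun_prop

lemma contDiffOn_transition (ε : ℤˣ) (i j : Fin 3) :
    ContDiffOn ℝ ∞ ((affineChart ε i).symm.trans (affineChart ε j))
      ((affineChart ε i).symm.trans (affineChart ε j)).source := by
  have key : ContDiffOn ℝ ∞
      (fun w : Fin 2 → ℂ => fun k => homog i 1 w (j.succAbove k) / homog i 1 w j)
      ((affineChart ε i).symm.trans (affineChart ε j)).source := by
    rw [contDiffOn_pi]
    intro k
    have hne : ∀ w ∈ ((affineChart ε i).symm.trans (affineChart ε j)).source,
        homog i 1 w j ≠ 0 := by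
      intro w hw
      rw [transition_source] at hw
      exact hw.2
    have h1 : ContDiffOn ℝ ∞ (fun w : Fin 2 → ℂ => (homog i 1 w j)⁻¹)
        ((affineChart ε i).symm.trans (affineChart ε j)).source :=
      (contDiff_homog i j).contDiffOn.inv hne
    simpa only [div_eq_mul_inv] using (contDiff_homog i _).contDiffOn.mul h1
  refine key.congr ?_
  intro w hw
  rw [transition_source] at hw
  exact transition_apply ε i j hw.1

/-- The atlas of affine charts. -/
noncomputable def affineAtlas (ε : ℤˣ) : ChartedSpaceCore (Fin 2 → ℂ) (SpaceForm ε) where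
  atlas := Set.range (affineChart ε)
  chartAt L := affineChart ε (chartIndex L)
  mem_chart_source L := chartIndex_spec L
  chart_mem_atlas L := Set.mem_range_self _
  open_source := by
    rintro _ _ ⟨i, rfl⟩ ⟨j, rfl⟩
    exact isOpen_transition_source ε i j
  continuousOn_toFun := by
    rintro _ _ ⟨i, rfl⟩ ⟨j, rfl⟩
    exact (contDiffOn_transition ε i j).continuousOn

noncomputable instance (ε : ℤˣ) : TopologicalSpace (SpaceForm ε) :=
  (affineAtlas ε).toTopologicalSpace

noncomputable instance (ε : ℤˣ) : ChartedSpace (Fin 2 → ℂ) (SpaceForm ε) :=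
  (affineAtlas ε).toChartedSpace

instance (ε : ℤˣ) : IsManifold 𝓘(ℝ, Fin 2 → ℂ) ∞ (SpaceForm ε) := by
  apply isManifold_of_contDiffOn
  intro e e' he he'
  have he1 : e ∈ ⋃ (f : PartialEquiv (SpaceForm ε) (Fin 2 → ℂ)) (hf : f ∈ (affineAtlas ε).atlas),
    {(affineAtlas ε).openPartialHomeomorph f hf} := he
  have he2 : e' ∈ ⋃ (f : PartialEquiv (SpaceForm ε) (Fin 2 → ℂ)) (hf : f ∈ (affineAtlas ε).atlas),
    {(affineAtlas ε).openPartialHomeomorph f hf} := he'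
  simp only [Set.mem_iUnion, Set.mem_singleton_iff] at he1 he2
  obtain ⟨_, ⟨i, rfl⟩, rfl⟩ := he1
  obtain ⟨_, ⟨j, rfl⟩, rfl⟩ := he2
  simp only [modelWithCornersSelf_coe, modelWithCornersSelf_coe_symm, Function.comp_id,
    Function.id_comp, Set.preimage_id, Set.range_id, Set.inter_univ]
  exact contDiffOn_transition ε i j

/-- The quotient metric at the line through `z`, evaluated on `ζ, ζ' ∈ ℂ³` (representing tangent
vectors of the quotient): `ζ, ζ'` are projected to the orthogonal complement of `z`, after `z` is
rescaled to the quadric `⟨z, z⟩ = ε r²`, and the real part of the Hermitian form is taken. -/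
noncomputable def homogMetric (ε : ℤˣ) (r : ℝ) (z ζ ζ' : Fin 3 → ℂ) : ℝ :=
  ((ε : ℤ) : ℝ) * r ^ 2 *
    (herm ε ζ ζ' / herm ε z z - herm ε ζ z * herm ε z ζ' / herm ε z z ^ 2).re

lemma homog_add (i : Fin 3) (u v : Fin 2 → ℂ) : homog i 0 (u + v) = homog i 0 u + homog i 0 v := by
  funext l
  rcases Fin.eq_self_or_eq_succAbove i l with rfl | ⟨k, rfl⟩ <;> simp

lemma homog_smul (i : Fin 3) (c : ℝ) (u : Fin 2 → ℂ) : homog i 0 (c • u) = c • homog i 0 u := by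
  funext l
  rcases Fin.eq_self_or_eq_succAbove i l with rfl | ⟨k, rfl⟩ <;> simp

lemma herm_add_left (ε : ℤˣ) (a b c : Fin 3 → ℂ) : herm ε (a + b) c = herm ε a c + herm ε b c := by
  simp only [herm, Pi.add_apply]; ring

lemma herm_add_right (ε : ℤˣ) (a b c : Fin 3 → ℂ) :
    herm ε a (b + c) = herm ε a b + herm ε a c := by
  simp only [herm, Pi.add_apply, star_add]; ring

lemma herm_smul_left (ε : ℤˣ) (t : ℝ) (a b : Fin 3 → ℂ) :
    herm ε (t • a) b = (t : ℂ) * herm ε a b := by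
  simp only [herm, Pi.smul_apply, Complex.real_smul]; ring

lemma herm_smul_right (ε : ℤˣ) (t : ℝ) (a b : Fin 3 → ℂ) :
    herm ε a (t • b) = (t : ℂ) * herm ε a b := by
  simp only [herm, Pi.smul_apply, Complex.real_smul, star_mul', Complex.star_def,
    Complex.conj_ofReal]
  ring

lemma isBilinearMap_homogMetric (ε : ℤˣ) (r : ℝ) (i : Fin 3) (z : Fin 3 → ℂ) :
    IsBilinearMap ℝ (fun u v : Fin 2 → ℂ => homogMetric ε r z (homog i 0 u) (homog i 0 v)) where
  add_left u v w := by
    simp only [homogMetric, homog_add, herm_add_left, ← mul_add, ← Complex.add_re]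
    congr 2; ring
  smul_left t u v := by
    simp only [homogMetric, homog_smul, herm_smul_left, smul_eq_mul]
    rw [mul_left_comm t, ← Complex.re_ofReal_mul t]
    congr 2; ring
  add_right u v w := by
    simp only [homogMetric, homog_add, herm_add_right, ← mul_add, ← Complex.add_re]
    congr 2; ring
  smul_right t u v := by
    simp only [homogMetric, homog_smul, herm_smul_right, smul_eq_mul]
    rw [mul_left_comm t, ← Complex.re_ofReal_mul t]
    congr 2; ring

/-- The metric of constant holomorphic sectional curvature `4 ε / r²` (Fubini-Study or Bergman) on
`ℂP²` or `ℂH²`: in the affine chart `i`, a point `w` stands for the line through the vector with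
`i`-th coordinate `1`, and a tangent vector `u` for the vector with `i`-th coordinate `0`. -/
noncomputable def spaceFormMetric (ε : ℤˣ) (r : ℝ) : Metric (Fin 2 → ℂ) (SpaceForm ε) :=
  fun L => (isBilinearMap_homogMetric ε r (chartIndex L)
    (homog (chartIndex L) 1 (affineChart ε (chartIndex L) L))).toContinuousBilinearMap

/-- The complex structure `J`: multiplication by `i` in the affine charts, which are
holomorphic. -/
noncomputable def complexStructure {ε : ℤˣ} (L : SpaceForm ε)
    (v : TangentSpace 𝓘(ℝ, Fin 2 → ℂ) L) : TangentSpace 𝓘(ℝ, Fin 2 → ℂ) L :=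
  let v' : Fin 2 → ℂ := v
  Complex.I • v'

end SpaceForm

/-! ### Hypersurfaces -/

section Hypersurface

variable {M : Type*} [TopologicalSpace M] [ChartedSpace (EuclideanSpace ℝ (Fin 3)) M]

/-- `ξ` is a smooth field of unit normals of `Φ : M → X` on the open set `U`. -/
def IsUnitNormalOn (ε : ℤˣ) (r : ℝ) (Φ : M → SpaceForm ε)
    (ξ : ∀ p, TangentSpace 𝓘(ℝ, Fin 2 → ℂ) (Φ p)) (U : Set M) : Prop :=
  IsOpen U ∧
  ContMDiffOn (𝓡 3) 𝓘(ℝ, Fin 2 → ℂ).tangent ∞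
    (fun p => (⟨Φ p, ξ p⟩ : TangentBundle 𝓘(ℝ, Fin 2 → ℂ) (SpaceForm ε))) U ∧
  ∀ p ∈ U, spaceFormMetric ε r (Φ p) (ξ p) (ξ p) = 1 ∧
    ∀ v : TangentSpace (𝓡 3) p,
      spaceFormMetric ε r (Φ p) (ξ p) (mfderiv (𝓡 3) 𝓘(ℝ, Fin 2 → ℂ) Φ p v) = 0

/-- The tangent vector of `M` at `p` that `dΦ` maps to `η`, for `η` in the image of `dΦ`. -/
noncomputable def tangentPreimage {ε : ℤˣ} (Φ : M → SpaceForm ε) (p : M)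
    (η : TangentSpace 𝓘(ℝ, Fin 2 → ℂ) (Φ p)) : TangentSpace (𝓡 3) p :=
  Function.invFun (mfderiv (𝓡 3) 𝓘(ℝ, Fin 2 → ℂ) Φ p) η

/-- The structure vector field `W = -J ξ`. -/
noncomputable def structureVector {ε : ℤˣ} (Φ : M → SpaceForm ε)
    (ξ : ∀ p, TangentSpace 𝓘(ℝ, Fin 2 → ℂ) (Φ p)) (p : M) : TangentSpace (𝓡 3) p :=
  tangentPreimage Φ p (-complexStructure (Φ p) (ξ p))

/-- The shape operator `A v = -∇_v ξ`, where `∇` is the Levi-Civita connection of the ambient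
space. -/
noncomputable def shapeOperator (ε : ℤˣ) (r : ℝ) (Φ : M → SpaceForm ε)
    (ξ : ∀ p, TangentSpace 𝓘(ℝ, Fin 2 → ℂ) (Φ p)) (p : M) (v : TangentSpace (𝓡 3) p) :
    TangentSpace (𝓡 3) p :=
  tangentPreimage Φ p (-covDerivAlong (spaceFormMetric ε r) Φ ξ p v)

/-- The distribution spanned by `W, A W, A² W, …`.  Locally there are just two choices of the unit
normal, `ξ` and `-ξ`; they give `±W` and `±A`, hence the same span, so that the supremum is this
common value. -/
noncomputable def hopfDistribution (ε : ℤˣ) (r : ℝ) (Φ : M → SpaceForm ε) (p : M) :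
    Submodule ℝ (TangentSpace (𝓡 3) p) :=
  ⨆ (ξ : ∀ p, TangentSpace 𝓘(ℝ, Fin 2 → ℂ) (Φ p)) (U : Set M)
    (_ : IsUnitNormalOn ε r Φ ξ U ∧ p ∈ U),
    Submodule.span ℝ (Set.range fun k : ℕ =>
      (shapeOperator ε r Φ ξ p)^[k] (structureVector Φ ξ p))

/-- The immersed hypersurface `Φ : M → X` is `k`-Hopf: the distribution spanned by
`W, A W, A² W, …` has rank `k` and is integrable. -/
def IsKHopf (ε : ℤˣ) (r : ℝ) (k : ℕ) (Φ : M → SpaceForm ε) : Prop :=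
  IsSmoothImmersion (E := EuclideanSpace ℝ (Fin 3)) (E' := Fin 2 → ℂ) Φ ∧
  (∀ p, Module.finrank ℝ (hopfDistribution ε r Φ p) = k) ∧
  IsIntegrable k (hopfDistribution ε r Φ)

end Hypersurface

end TwoHopf

/-!
The leaves of `ℋ` are flat because each of them carries a nonzero parallel vector field.

Let `f = Φ ∘ j` be a leaf, with a local unit normal `ξ` of the hypersurface along it. The tangent
planes of the leaf are those of `ℋ = span {W, A W, …}`: they have dimension two, are orthogonal to
`ξ`, and contain `W = -J ξ`. Hence the skew form `⟨J ·, ·⟩` on each of them has `W` in its radical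
and vanishes: the leaf is Lagrangian. Since `ℋ` is invariant under `A`, the covariant derivative of
`ξ` along the leaf is tangent to the leaf. As `J` is parallel, the covariant derivative of `J ξ` is
`J ∇ ξ`, which is normal to the leaf; so the field on the leaf that `df` maps to `J ξ` is parallel
for the induced metric. The curvature operators annihilate a parallel field and are skew-symmetric,
and in dimension two this forces them to vanish.

The argument is carried out in one affine chart of the space form and one chart of the leaf:
`pullback_flat_of_normal` is the statement for a surface in a vector space with a Kähler metric. It
rests on `christoffelLower_of_pullback`, `curvature_eq_zero_of_parallel` and `curvature_skew`. The
closed form of the Christoffel symbols of the space form (`christoffel_chartMetric`) is complex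
linear, which is the parallelism of `J`. The definitions of the hypersurface use the preferred chart
at each point, which depends on the point in no continuous way; `spaceFormMetric_eq` and
`chartDeriv_covDeriv` move the metric and the covariant derivative to a fixed affine chart. Finally,
`IsUnitNormalOn.hopfSpace_eq` shows that every local unit normal gives the same distribution, and
`IsUnitNormalOn.shapeOp_mem` its invariance under the shape operator.
-/

namespace TwoHopf

open Filter Topology

/-! ### The Levi-Civita connection of a metric on a vector space -/

section LeviCivita

-- Instances on nested spaces of continuous linear maps exceed the default search bounds.
set_option synthInstance.maxHeartbeats 200000
set_option maxSynthPendingDepth 3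

variable {E : Type*} [NormedAddCommGroup E] [NormedSpace ℝ E]
  {E' : Type*} [NormedAddCommGroup E'] [NormedSpace ℝ E']

lemma fderiv_apply_apply {G : E → E' →L[ℝ] E' →L[ℝ] ℝ} {x : E} (hG : DifferentiableAt ℝ G x)
    (a : E) (u v : E') : fderiv ℝ G x a u v = fderiv ℝ (fun y => G y u v) x a := by
  rw [fderiv_clm_apply (hG.clm_apply (differentiableAt_const u)) (differentiableAt_const v),
    fderiv_clm_apply hG (differentiableAt_const u)]
  simp

lemma contDiff_flip {F : Type*} [NormedAddCommGroup F] [NormedSpace ℝ F] {n : ℕ∞ω} :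
    ContDiff ℝ n (fun T : E →L[ℝ] E' →L[ℝ] F => T.flip) :=
  (ContinuousLinearMap.flipₗᵢ ℝ E E' F).contDiff

lemma contDiffAt_bilinearComp {n : ℕ∞ω} {B : E → E' →L[ℝ] E' →L[ℝ] ℝ} {T : E → E →L[ℝ] E'} {x : E}
    (hB : ContDiffAt ℝ n B x) (hT : ContDiffAt ℝ n T x) :
    ContDiffAt ℝ n (fun y => (B y).bilinearComp (T y) (T y)) x := by
  have h1 : ContDiffAt ℝ n (fun y => (B y ∘L T y).flip) x :=
    contDiff_flip.contDiffAt.comp x (hB.clm_comp hT)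
  exact contDiff_flip.contDiffAt.comp x (h1.clm_comp hT)

lemma christoffelLower_apply (G : E → E →L[ℝ] E →L[ℝ] ℝ) (x u v w : E) :
    christoffelLower G x u v w =
      (1 / 2) * (fderiv ℝ G x u v w + fderiv ℝ G x v u w - fderiv ℝ G x w u v) := by
  simp [christoffelLower]

lemma christoffel_congr {G G' : E → E →L[ℝ] E →L[ℝ] ℝ} {x : E} (h : G =ᶠ[𝓝 x] G') :
    christoffel G x = christoffel G' x := by
  funext u v
  simp only [christoffel, christoffelLower, h.fderiv_eq, h.eq_of_nhds]

lemma apply_christoffel {G : E → E →L[ℝ] E →L[ℝ] ℝ} {x : E} (h : (G x).IsInvertible) (u v w : E) :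
    G x (christoffel G x u v) w = christoffelLower G x u v w := by
  rw [christoffel, h.self_apply_inverse]

/-- The Christoffel symbols of a pulled back metric: the second derivative of the map enters as
the correction term. -/
theorem christoffelLower_of_pullback {G : E → E →L[ℝ] E →L[ℝ] ℝ} {G' : E' → E' →L[ℝ] E' →L[ℝ] ℝ}
    {F : E → E'} {x : E} (hF : ContDiffAt ℝ 2 F x) (hG' : ContDiffAt ℝ 1 G' (F x))
    (hsymm : ∀ a b, G' (F x) a b = G' (F x) b a)
    (hG : ∀ᶠ y in 𝓝 x, ∀ u v, G y u v = G' (F y) (fderiv ℝ F y u) (fderiv ℝ F y v)) (u v w : E) :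
    christoffelLower G x u v w =
      christoffelLower G' (F x) (fderiv ℝ F x u) (fderiv ℝ F x v) (fderiv ℝ F x w)
        + G' (F x) (fderiv ℝ (fderiv ℝ F) x u v) (fderiv ℝ F x w) := by
  have hDF : ContDiffAt ℝ 1 (fderiv ℝ F) x := hF.fderiv_right (m := 1) (by norm_num)
  have hGF : ContDiffAt ℝ 1 (fun y => G' (F y)) x := hG'.comp x (hF.of_le (by norm_num))
  have hDF' : DifferentiableAt ℝ (fderiv ℝ F) x := hDF.differentiableAt (by norm_num)
  have hGF' : DifferentiableAt ℝ (fun y => G' (F y)) x := hGF.differentiableAt (by norm_num)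
  have hGd : DifferentiableAt ℝ G x := by
    have h1 := (contDiffAt_bilinearComp hGF hDF).differentiableAt (by norm_num)
    refine h1.congr_of_eventuallyEq ?_
    filter_upwards [hG] with y hy
    ext u v
    simpa using hy u v
  have hsec : IsSymmSndFDerivAt ℝ F x := hF.isSymmSndFDerivAt (by simp)
  have hchain : ∀ a, fderiv ℝ (fun y => G' (F y)) x a = fderiv ℝ G' (F x) (fderiv ℝ F x a) := by
    intro a
    have := fderiv_comp (𝕜 := ℝ) x (hG'.differentiableAt (by norm_num))
      (hF.differentiableAt (by norm_num))
    change fderiv ℝ (G' ∘ F) x a = _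
    rw [this]; rfl
  have key : ∀ a b c : E, fderiv ℝ G x a b c =
      fderiv ℝ G' (F x) (fderiv ℝ F x a) (fderiv ℝ F x b) (fderiv ℝ F x c)
      + G' (F x) (fderiv ℝ (fderiv ℝ F) x a b) (fderiv ℝ F x c)
      + G' (F x) (fderiv ℝ F x b) (fderiv ℝ (fderiv ℝ F) x a c) := by
    intro a b c
    rw [fderiv_apply_apply hGd]
    have h2 : (fun y => G y b c) =ᶠ[𝓝 x]
        fun y => G' (F y) (fderiv ℝ F y b) (fderiv ℝ F y c) := by
      filter_upwards [hG] with y hy using hy b c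
    have hb : DifferentiableAt ℝ (fun y => fderiv ℝ F y b) x :=
      hDF'.clm_apply (differentiableAt_const b)
    have hc : DifferentiableAt ℝ (fun y => fderiv ℝ F y c) x :=
      hDF'.clm_apply (differentiableAt_const c)
    rw [h2.fderiv_eq, fderiv_clm_apply (hGF'.clm_apply hb) hc, fderiv_clm_apply hGF' hb,
      fderiv_clm_apply hDF' (differentiableAt_const b),
      fderiv_clm_apply hDF' (differentiableAt_const c)]
    simp [hchain]
    ring
  rw [christoffelLower_apply, christoffelLower_apply, key, key, key, hsec.eq v u, hsec.eq w u,
    hsec.eq w v, hsymm (fderiv ℝ F x u) (fderiv ℝ (fderiv ℝ F) x v w),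
    hsymm (fderiv ℝ F x v) (fderiv ℝ (fderiv ℝ F) x u w)]
  ring

/-- A symmetric connection that is compatible with a metric has the Christoffel symbols of that
metric. -/
theorem christoffelLower_eq_of_compatible {G : E → E →L[ℝ] E →L[ℝ] ℝ} {x : E} {Γ : E → E → E}
    (hsymm : ∀ a b, G x a b = G x b a) (hΓ : ∀ u v, Γ u v = Γ v u)
    (hc : ∀ a u v, fderiv ℝ G x a u v = G x (Γ a u) v + G x u (Γ a v)) (u v w : E) :
    christoffelLower G x u v w = G x (Γ u v) w := by
  rw [christoffelLower_apply, hc, hc, hc, hΓ v u, hΓ w u, hΓ w v, hsymm u (Γ v w),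
    hsymm v (Γ u w)]
  ring

lemma fderiv_symm_of_symm {G : E → E →L[ℝ] E →L[ℝ] ℝ} {x : E} (hd : DifferentiableAt ℝ G x)
    (hs : ∀ᶠ y in 𝓝 x, ∀ a b, G y a b = G y b a) (a b c : E) :
    fderiv ℝ G x a b c = fderiv ℝ G x a c b := by
  rw [fderiv_apply_apply hd, fderiv_apply_apply hd]
  congr 1
  apply Filter.EventuallyEq.fderiv_eq
  filter_upwards [hs] with y hy using hy b c

/-- The Levi-Civita connection preserves the metric. -/
theorem christoffel_compatible {G : E → E →L[ℝ] E →L[ℝ] ℝ} {x : E} (hd : DifferentiableAt ℝ G x)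
    (hs : ∀ᶠ y in 𝓝 x, ∀ a b, G y a b = G y b a) (hi : (G x).IsInvertible) (a u v : E) :
    fderiv ℝ G x a u v = G x (christoffel G x a u) v + G x u (christoffel G x a v) := by
  rw [hs.self_of_nhds u, apply_christoffel hi, apply_christoffel hi, christoffelLower_apply,
    christoffelLower_apply, fderiv_symm_of_symm hd hs v a u, fderiv_symm_of_symm hd hs u a v,
    fderiv_symm_of_symm hd hs a v u]
  ring

/-- The Christoffel symbols at `x` as a bundled bilinear map. -/
noncomputable def christoffelCLM (G : E → E →L[ℝ] E →L[ℝ] ℝ) (x : E) : E →L[ℝ] E →L[ℝ] E :=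
  ContinuousLinearMap.compL ℝ E (E →L[ℝ] ℝ) E (G x).inverse ∘L
    ((1 / 2 : ℝ) • (fderiv ℝ G x + (fderiv ℝ G x).flip
      - (ContinuousLinearMap.flipₗᵢ ℝ E E ℝ).toContinuousLinearEquiv.toContinuousLinearMap ∘L
          (fderiv ℝ G x).flip))

lemma christoffelCLM_apply (G : E → E →L[ℝ] E →L[ℝ] ℝ) (x u v : E) :
    christoffelCLM G x u v = christoffel G x u v := by
  simp only [christoffelCLM, christoffel, christoffelLower, ContinuousLinearMap.comp_apply]
  simp only [ContinuousLinearMap.compL_apply, ContinuousLinearMap.comp_apply]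
  congr 1

lemma contDiffAt_christoffelCLM [CompleteSpace E] {G : E → E →L[ℝ] E →L[ℝ] ℝ} {x : E}
    (hG : ContDiffAt ℝ ∞ G x) (hi : (G x).IsInvertible) :
    ContDiffAt ℝ ∞ (christoffelCLM G) x := by
  have h1 : ContDiffAt ℝ ∞ (fun y => (G y).inverse) x := hi.contDiffAt_map_inverse.comp x hG
  have h2 : ContDiffAt ℝ ∞ (fderiv ℝ G) x := hG.fderiv_right (m := ∞) (by simp)
  have h3 : ContDiffAt ℝ ∞ (fun y => (fderiv ℝ G y).flip) x :=
    contDiff_flip.contDiffAt.comp x h2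
  have h4 : ContDiffAt ℝ ∞ (fun y => ContinuousLinearMap.compL ℝ E (E →L[ℝ] ℝ) E (G y).inverse) x :=
    (ContinuousLinearMap.compL ℝ E (E →L[ℝ] ℝ) E).contDiff.contDiffAt.comp x h1
  exact h4.clm_comp (((h2.add h3).sub (contDiffAt_const.clm_comp h3)).const_smul _)

/-- The curvature in terms of the derivative of the bundled Christoffel symbols; in this form its
linearity in each argument is visible. -/
lemma curvature_eq [CompleteSpace E] {G : E → E →L[ℝ] E →L[ℝ] ℝ} {x : E}
    (hG : ContDiffAt ℝ ∞ G x) (hi : (G x).IsInvertible) (u v w : E) :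
    curvature G x u v w = fderiv ℝ (christoffelCLM G) x u v w - fderiv ℝ (christoffelCLM G) x v u w
      + christoffelCLM G x u (christoffelCLM G x v w)
      - christoffelCLM G x v (christoffelCLM G x u w) := by
  have hd : DifferentiableAt ℝ (christoffelCLM G) x :=
    (contDiffAt_christoffelCLM hG hi).differentiableAt (by simp)
  have key : ∀ a b c, fderiv ℝ (fun y => christoffel G y b c) x a =
      fderiv ℝ (christoffelCLM G) x a b c := by
    intro a b c
    simp only [← christoffelCLM_apply]
    rw [fderiv_clm_apply (hd.clm_apply (differentiableAt_const b)) (differentiableAt_const c),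
      fderiv_clm_apply hd (differentiableAt_const b)]
    simp
  simp only [curvature, key, christoffelCLM_apply]

/-- A vector field with vanishing covariant derivative is annihilated by the curvature. -/
theorem curvature_eq_zero_of_parallel [CompleteSpace E] {G : E → E →L[ℝ] E →L[ℝ] ℝ} {x : E}
    {w : E → E} (hG : ContDiffAt ℝ ∞ G x) (hi : (G x).IsInvertible) (hw : ContDiffAt ℝ 2 w x)
    (hpar : ∀ᶠ y in 𝓝 x, ∀ u, fderiv ℝ w y u + christoffel G y u (w y) = 0) (u v : E) :
    curvature G x u v (w x) = 0 := by
  have hd : DifferentiableAt ℝ (christoffelCLM G) x :=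
    (contDiffAt_christoffelCLM hG hi).differentiableAt (by simp)
  have hDw : DifferentiableAt ℝ (fderiv ℝ w) x :=
    (hw.fderiv_right (m := 1) (by norm_num)).differentiableAt (by norm_num)
  have hwd : DifferentiableAt ℝ w x := hw.differentiableAt (by norm_num)
  have hsec : IsSymmSndFDerivAt ℝ w x := hw.isSymmSndFDerivAt (by simp)
  have h1 : ∀ᶠ y in 𝓝 x, ∀ u, fderiv ℝ w y u = - christoffelCLM G y u (w y) := by
    filter_upwards [hpar] with y hy a
    rw [christoffelCLM_apply]
    exact eq_neg_of_add_eq_zero_left (hy a)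
  have h2 : ∀ a b, fderiv ℝ (fderiv ℝ w) x a b =
      - (fderiv ℝ (christoffelCLM G) x a b (w x)
        - christoffelCLM G x b (christoffelCLM G x a (w x))) := by
    intro a b
    have e1 : fderiv ℝ (fderiv ℝ w) x a b = fderiv ℝ (fun y => fderiv ℝ w y b) x a := by
      rw [fderiv_clm_apply hDw (differentiableAt_const b)]; simp
    have e2 : (fun y => fderiv ℝ w y b) =ᶠ[𝓝 x] fun y => - christoffelCLM G y b (w y) := by
      filter_upwards [h1] with y hy using hy b
    rw [e1, e2.fderiv_eq, fderiv_fun_neg,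
      fderiv_clm_apply (hd.clm_apply (differentiableAt_const b)) hwd,
      fderiv_clm_apply hd (differentiableAt_const b)]
    simp [h1.self_of_nhds, neg_add_eq_sub]
  have h3 := hsec.eq u v
  rw [h2, h2] at h3
  rw [curvature_eq hG hi]
  have h4 := neg_injective h3
  rw [sub_eq_sub_iff_add_eq_add] at h4
  rw [sub_add_eq_add_sub, sub_sub, sub_eq_zero, h4, add_comm]

/-- The curvature operators of a metric are skew-symmetric. -/
theorem curvature_skew [CompleteSpace E] {G : E → E →L[ℝ] E →L[ℝ] ℝ} {x : E}
    (hG : ContDiffAt ℝ ∞ G x) (hs : ∀ᶠ y in 𝓝 x, ∀ a b, G y a b = G y b a)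
    (hi : ∀ᶠ y in 𝓝 x, (G y).IsInvertible) (u v a b : E) :
    G x (curvature G x u v a) b + G x a (curvature G x u v b) = 0 := by
  have hGd : ∀ᶠ y in 𝓝 x, DifferentiableAt ℝ G y := by
    have := (hG.of_le (m := 1) (by norm_cast)).eventually (by simp)
    filter_upwards [this] with y hy using hy.differentiableAt (by norm_num)
  have hc : ∀ᶠ y in 𝓝 x, ∀ a u v, fderiv ℝ G y a u v =
      G y (christoffelCLM G y a u) v + G y u (christoffelCLM G y a v) := by
    filter_upwards [hGd, hs.eventually_nhds, hi] with y h1 h2 h3 a u v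
    simp only [christoffelCLM_apply]
    exact christoffel_compatible h1 h2 h3 a u v
  have hd : DifferentiableAt ℝ (christoffelCLM G) x :=
    (contDiffAt_christoffelCLM hG hi.self_of_nhds).differentiableAt (by simp)
  have hGd0 := hGd.self_of_nhds
  have hDG : DifferentiableAt ℝ (fderiv ℝ G) x :=
    (hG.fderiv_right (m := 1) (by norm_cast)).differentiableAt (by norm_num)
  have hsec : IsSymmSndFDerivAt ℝ G x := hG.isSymmSndFDerivAt (by simp; norm_cast)
  have key : ∀ d e, fderiv ℝ (fderiv ℝ G) x d e a b =
      G x (christoffelCLM G x d (christoffelCLM G x e a)) b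
      + G x (christoffelCLM G x e a) (christoffelCLM G x d b)
      + G x (fderiv ℝ (christoffelCLM G) x d e a) b
      + (G x (christoffelCLM G x d a) (christoffelCLM G x e b)
      + G x a (christoffelCLM G x d (christoffelCLM G x e b))
      + G x a (fderiv ℝ (christoffelCLM G) x d e b)) := by
    intro d e
    have e1 : fderiv ℝ (fderiv ℝ G) x d e a b = fderiv ℝ (fun y => fderiv ℝ G y e a b) x d := by
      rw [fderiv_clm_apply ((hDG.clm_apply (differentiableAt_const e)).clm_apply
        (differentiableAt_const a)) (differentiableAt_const b),
        fderiv_clm_apply (hDG.clm_apply (differentiableAt_const e)) (differentiableAt_const a),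
        fderiv_clm_apply hDG (differentiableAt_const e)]
      simp
    have e2 : (fun y => fderiv ℝ G y e a b) =ᶠ[𝓝 x] fun y =>
        G y (christoffelCLM G y e a) b + G y a (christoffelCLM G y e b) := by
      filter_upwards [hc] with y hy using hy e a b
    have hΓ : ∀ c, DifferentiableAt ℝ (fun y => christoffelCLM G y e c) x := fun c =>
      (hd.clm_apply (differentiableAt_const e)).clm_apply (differentiableAt_const c)
    have hΓ' : ∀ c, fderiv ℝ (fun y => christoffelCLM G y e c) x d =
        fderiv ℝ (christoffelCLM G) x d e c := by
      intro c
      rw [fderiv_clm_apply (hd.clm_apply (differentiableAt_const e)) (differentiableAt_const c),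
        fderiv_clm_apply hd (differentiableAt_const e)]
      simp
    rw [e1, e2.fderiv_eq, fderiv_fun_add
      ((hGd0.clm_apply (hΓ a)).clm_apply (differentiableAt_const b))
      ((hGd0.clm_apply (differentiableAt_const a)).clm_apply (hΓ b)),
      fderiv_clm_apply (hGd0.clm_apply (hΓ a)) (differentiableAt_const b),
      fderiv_clm_apply hGd0 (hΓ a),
      fderiv_clm_apply (hGd0.clm_apply (differentiableAt_const a)) (hΓ b),
      fderiv_clm_apply hGd0 (differentiableAt_const a)]
    simp [hΓ', hc.self_of_nhds]
    ring
  have h := congrArg (fun T => T a b) (hsec.eq u v)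
  simp only [key] at h
  rw [curvature_eq hG hi.self_of_nhds, curvature_eq hG hi.self_of_nhds]
  simp only [map_sub, map_add, sub_apply, add_apply]
  linarith

/-- A skew-symmetric bilinear form on a plane with a nonzero vector in its radical vanishes. -/
lemma skew_form_eq_zero {β : EuclideanSpace ℝ (Fin 2) → EuclideanSpace ℝ (Fin 2) → ℝ}
    (hadd : ∀ a b c, β (a + b) c = β a c + β b c) (hsmul : ∀ (t : ℝ) a c, β (t • a) c = t * β a c)
    (hskew : ∀ a b, β a b = - β b a) {w : EuclideanSpace ℝ (Fin 2)} (hw : w ≠ 0)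
    (hker : ∀ b, β w b = 0) (a b : EuclideanSpace ℝ (Fin 2)) : β a b = 0 := by
  set e₀ : EuclideanSpace ℝ (Fin 2) := EuclideanSpace.single 0 1
  set e₁ : EuclideanSpace ℝ (Fin 2) := EuclideanSpace.single 1 1
  have hdec : ∀ a : EuclideanSpace ℝ (Fin 2), a = a 0 • e₀ + a 1 • e₁ := by
    intro a
    ext i
    fin_cases i <;> simp [e₀, e₁]
  have hself : ∀ a, β a a = 0 := fun a => by linarith [hskew a a]
  have hexp : ∀ a c, β a c = a 0 * β e₀ c + a 1 * β e₁ c := by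
    intro a c
    conv_lhs => rw [hdec a]
    rw [hadd, hsmul, hsmul]
  have h01 : β e₀ e₁ = 0 := by
    have h0 := hker e₀
    have h1 := hker e₁
    rw [hexp, hself, mul_zero] at h0 h1
    rw [hskew e₁ e₀] at h0
    by_contra hne
    apply hw
    ext i
    fin_cases i
    · simpa [hne] using h1
    · simpa [hne] using h0
  have h10 : β e₁ e₀ = 0 := by rw [hskew, h01, neg_zero]
  rw [hexp, hskew e₀, hskew e₁, hexp b e₀, hexp b e₁, hself, hself, h01, h10]
  ring

end LeviCivita

/-! ### Flat Lagrangian surfaces -/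

section Lagrangian

variable {E : Type*} [NormedAddCommGroup E] [NormedSpace ℝ E]

lemma isInvertible_of_posDef [FiniteDimensional ℝ E] {B : E →L[ℝ] E →L[ℝ] ℝ}
    (hB : ∀ a, a ≠ 0 → 0 < B a a) : B.IsInvertible := by
  have hinj : Function.Injective B := by
    rw [injective_iff_map_eq_zero]
    intro a ha
    by_contra hne
    have := hB a hne
    rw [ha] at this
    simp at this
  have hfin : Module.finrank ℝ E = Module.finrank ℝ (E →L[ℝ] ℝ) := by
    rw [← (LinearMap.toContinuousLinearMap (𝕜 := ℝ) (E := E) (F' := ℝ)).finrank_eq]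
    exact (Subspace.dual_finrank_eq (K := ℝ) (V := E)).symm
  let e := LinearMap.linearEquivOfInjective (B : E →ₗ[ℝ] E →L[ℝ] ℝ) hinj hfin
  exact ⟨e.toContinuousLinearEquiv, by ext; rfl⟩

/-- Flatness of an immersed surface `F` in a Kähler manifold (with metric `G'` and complex structure
`J`, in a chart) that has a normal field `N` with `J N` tangent to the surface and the covariant
derivative of `N` tangent to the surface.  The surface is Lagrangian, and the vector field that
`dF` maps to `J N` is parallel: its covariant derivative is the tangential part of `J ∇ N`. -/
theorem pullback_flat_of_normal [CompleteSpace E]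
    {V : Set (EuclideanSpace ℝ (Fin 2))} (hV : IsOpen V)
    {G : EuclideanSpace ℝ (Fin 2) → EuclideanSpace ℝ (Fin 2) →L[ℝ] EuclideanSpace ℝ (Fin 2) →L[ℝ] ℝ}
    {G' : E → E →L[ℝ] E →L[ℝ] ℝ} {F N : EuclideanSpace ℝ (Fin 2) → E} {J : E →L[ℝ] E}
    (hJ : ∀ a, J (J a) = - a)
    (hF : ∀ y ∈ V, ContDiffAt ℝ ∞ F y) (hN : ∀ y ∈ V, ContDiffAt ℝ ∞ N y)
    (hG' : ∀ y ∈ V, ContDiffAt ℝ ∞ G' (F y))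
    (hsymm : ∀ y ∈ V, ∀ a b, G' (F y) a b = G' (F y) b a)
    (hpos : ∀ y ∈ V, ∀ a, a ≠ 0 → 0 < G' (F y) a a)
    (hinv : ∀ y ∈ V, (G' (F y)).IsInvertible)
    (hskew : ∀ y ∈ V, ∀ a b, G' (F y) (J a) b = - G' (F y) a (J b))
    (hpar : ∀ y ∈ V, ∀ a b, christoffel G' (F y) a (J b) = J (christoffel G' (F y) a b))
    (hG : ∀ y ∈ V, ∀ u v, G y u v = G' (F y) (fderiv ℝ F y u) (fderiv ℝ F y v))
    (hinj : ∀ y ∈ V, Function.Injective (fderiv ℝ F y))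
    (hN0 : ∀ y ∈ V, N y ≠ 0)
    (hnormal : ∀ y ∈ V, ∀ u, G' (F y) (N y) (fderiv ℝ F y u) = 0)
    (hJN : ∀ y ∈ V, ∃ w, fderiv ℝ F y w = J (N y))
    (hDN : ∀ y ∈ V, ∀ u, ∃ c,
      fderiv ℝ F y c = fderiv ℝ N y u + christoffel G' (F y) (fderiv ℝ F y u) (N y))
    {y : EuclideanSpace ℝ (Fin 2)} (hy : y ∈ V) (u v a b : EuclideanSpace ℝ (Fin 2)) :
    G y (curvature G y u v a) b = 0 := by
  have hDF : ∀ y ∈ V, ContDiffAt ℝ ∞ (fderiv ℝ F) y := fun y hy =>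
    (hF y hy).fderiv_right (m := ∞) (by simp)
  have hVy : ∀ y ∈ V, ∀ᶠ z in 𝓝 y, z ∈ V := fun y hy => hV.mem_nhds hy
  have hGs : ∀ y ∈ V, ContDiffAt ℝ ∞ G y := by
    intro y hy
    refine (contDiffAt_bilinearComp ((hG' y hy).comp y (hF y hy)) (hDF y hy)).congr_of_eventuallyEq
      ?_
    filter_upwards [hVy y hy] with z hz
    ext a b
    simpa using hG z hz a b
  have hGsymm : ∀ y ∈ V, ∀ a b, G y a b = G y b a := by
    intro y hy a b
    rw [hG y hy, hG y hy, hsymm y hy]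
  have hGpos : ∀ y ∈ V, ∀ a, a ≠ 0 → 0 < G y a a := by
    intro y hy a ha
    rw [hG y hy]
    refine hpos y hy _ fun h => ha ?_
    exact hinj y hy (by rw [h, map_zero])
  have hGinv : ∀ y ∈ V, (G y).IsInvertible := fun y hy => isInvertible_of_posDef (hGpos y hy)
  -- The vector field `w` with `dF(w) = J N`, written so that its smoothness is visible.
  let w : EuclideanSpace ℝ (Fin 2) → EuclideanSpace ℝ (Fin 2) := fun z =>
    (G z).inverse ((G' (F z) (J (N z))) ∘L fderiv ℝ F z)
  have hw : ∀ y ∈ V, fderiv ℝ F y (w y) = J (N y) := by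
    intro y hy
    obtain ⟨w₀, h₀⟩ := hJN y hy
    have : G y w₀ = (G' (F y) (J (N y))) ∘L fderiv ℝ F y := by
      ext b
      rw [hG y hy, h₀]; rfl
    have h1 : w y = w₀ := by
      change (G y).inverse _ = _
      rw [← this, (hGinv y hy).inverse_apply_self]
    rw [h1, h₀]
  have hws : ∀ y ∈ V, ContDiffAt ℝ ∞ w y := by
    intro y hy
    have h1 : ContDiffAt ℝ ∞ (fun z => (G z).inverse) y :=
      (hGinv y hy).contDiffAt_map_inverse.comp y (hGs y hy)
    have h2 : ContDiffAt ℝ ∞ (fun z => G' (F z)) y := (hG' y hy).comp y (hF y hy)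
    exact h1.clm_apply ((h2.clm_apply (J.contDiff.contDiffAt.comp y (hN y hy))).clm_comp (hDF y hy))
  have hw0 : ∀ y ∈ V, w y ≠ 0 := by
    intro y hy h
    have h1 := hw y hy
    rw [h, map_zero] at h1
    have h2 := hJ (N y)
    rw [← h1, map_zero] at h2
    exact hN0 y hy (neg_eq_zero.1 h2.symm)
  have hlag : ∀ y ∈ V, ∀ a b, G' (F y) (J (fderiv ℝ F y a)) (fderiv ℝ F y b) = 0 := by
    intro y hy
    refine skew_form_eq_zero (β := fun a b => G' (F y) (J (fderiv ℝ F y a)) (fderiv ℝ F y b))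
      (fun a b c => by simp) (fun t a c => by simp) (fun a b => ?_) (hw0 y hy) (fun b => ?_)
    · rw [hskew y hy, hsymm y hy]
    · rw [hw y hy, hJ, map_neg, neg_apply, hnormal y hy, neg_zero]
  have hwpar : ∀ y ∈ V, ∀ u, fderiv ℝ w y u + christoffel G y u (w y) = 0 := by
    intro y hy u
    have hdDF : DifferentiableAt ℝ (fderiv ℝ F) y := (hDF y hy).differentiableAt (by simp)
    have hdw : DifferentiableAt ℝ w y := (hws y hy).differentiableAt (by simp)
    have hdN : DifferentiableAt ℝ N y := (hN y hy).differentiableAt (by simp)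
    have h1 : fderiv ℝ (fun z => fderiv ℝ F z (w z)) y u = J (fderiv ℝ N y u) := by
      have e1 : (fun z => fderiv ℝ F z (w z)) =ᶠ[𝓝 y] J ∘ N := by
        filter_upwards [hVy y hy] with z hz using hw z hz
      rw [e1.fderiv_eq, fderiv_comp y J.differentiableAt hdN, J.fderiv]
      rfl
    rw [fderiv_clm_apply hdDF hdw] at h1
    have h1' : fderiv ℝ F y (fderiv ℝ w y u) + fderiv ℝ (fderiv ℝ F) y u (w y)
        = J (fderiv ℝ N y u) := by simpa using h1
    have h2 : ∀ b, G y (fderiv ℝ w y u + christoffel G y u (w y)) b = 0 := by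
      intro b
      obtain ⟨c, hc⟩ := hDN y hy u
      have h3 : ∀ᶠ z in 𝓝 y, ∀ u v, G z u v = G' (F z) (fderiv ℝ F z u) (fderiv ℝ F z v) := by
        filter_upwards [hVy y hy] with z hz using hG z hz
      rw [map_add, add_apply, apply_christoffel (hGinv y hy),
        christoffelLower_of_pullback ((hF y hy).of_le (by norm_cast))
          ((hG' y hy).of_le (by norm_cast)) (hsymm y hy) h3,
        ← apply_christoffel (hinv y hy), hw y hy, hpar y hy, hG y hy,
        add_left_comm, ← add_apply, ← map_add, h1', ← add_apply, ← map_add, ← map_add,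
        add_comm (christoffel _ _ _ _), ← hc, hlag y hy]
    by_contra hne
    exact (hGpos y hy _ hne).ne' (h2 _)
  have hR : ∀ u v, curvature G y u v (w y) = 0 := fun u v =>
    curvature_eq_zero_of_parallel (hGs y hy) (hGinv y hy) ((hws y hy).of_le (by norm_cast))
      (by filter_upwards [hVy y hy] with z hz using hwpar z hz) u v
  have hRlin := curvature_eq (hGs y hy) (hGinv y hy)
  refine skew_form_eq_zero (β := fun a b => G y (curvature G y u v a) b)
    (fun a b c => ?_) (fun t a c => ?_) (fun a b => ?_) (hw0 y hy) (fun b => ?_) a b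
  · simp only [hRlin, map_add, map_sub, add_apply, sub_apply]
    ring
  · simp only [hRlin, map_smul, map_add, map_sub, add_apply, sub_apply, smul_apply, smul_eq_mul]
    ring
  · have := curvature_skew (hGs y hy) (by filter_upwards [hVy y hy] with z hz using hGsymm z hz)
      (by filter_upwards [hVy y hy] with z hz using hGinv z hz) u v a b
    rw [hGsymm y hy a] at this
    linarith
  · simp [hR]

end Lagrangian

/-! ### The metric of the space form in an affine chart -/

section ChartMetric

lemma star_herm (ε : ℤˣ) (a b : Fin 3 → ℂ) : star (herm ε a b) = herm ε b a := by
  simp [herm, mul_comm]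

lemma herm_smul_left' (ε : ℤˣ) (c : ℂ) (a b : Fin 3 → ℂ) :
    herm ε (c • a) b = c * herm ε a b := by
  simp only [herm, Pi.smul_apply, smul_eq_mul]; ring

lemma herm_smul_right' (ε : ℤˣ) (c : ℂ) (a b : Fin 3 → ℂ) :
    herm ε a (c • b) = star c * herm ε a b := by
  simp only [herm, Pi.smul_apply, smul_eq_mul, star_mul']; ring

lemma IsAdmissible.herm_ne_zero {ε : ℤˣ} {z : Fin 3 → ℂ} (h : IsAdmissible ε z) :
    herm ε z z ≠ 0 := by
  intro h0
  simp [IsAdmissible, h0] at h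

lemma ofReal_herm_re (ε : ℤˣ) (z : Fin 3 → ℂ) : ((herm ε z z).re : ℂ) = herm ε z z :=
  Complex.conj_eq_iff_re.1 (star_herm ε z z)

lemma homog_complex_smul (i : Fin 3) (c : ℂ) (u : Fin 2 → ℂ) :
    homog i 0 (c • u) = c • homog i 0 u := by
  funext l
  rcases Fin.eq_self_or_eq_succAbove i l with rfl | ⟨k, rfl⟩ <;> simp

lemma homog_one_add_smul (i : Fin 3) (w a : Fin 2 → ℂ) (t : ℝ) :
    homog i 1 (w + t • a) = homog i 1 w + t • homog i 0 a := by
  funext l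
  rcases Fin.eq_self_or_eq_succAbove i l with rfl | ⟨k, rfl⟩ <;> simp

/-- The Hermitian form on `ℂ³`, degenerate along `z`, whose real part is the quotient metric at the
line through `z`, up to the factor `ε r²`. -/
noncomputable def homogForm (ε : ℤˣ) (z ζ ζ' : Fin 3 → ℂ) : ℂ :=
  herm ε ζ ζ' / herm ε z z - herm ε ζ z * herm ε z ζ' / herm ε z z ^ 2

lemma homogMetric_eq (ε : ℤˣ) (r : ℝ) (z ζ ζ' : Fin 3 → ℂ) :
    homogMetric ε r z ζ ζ' = ((ε : ℤ) : ℝ) * r ^ 2 * (homogForm ε z ζ ζ').re := rfl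

lemma star_homogForm (ε : ℤˣ) (z ζ ζ' : Fin 3 → ℂ) :
    star (homogForm ε z ζ ζ') = homogForm ε z ζ' ζ := by
  simp only [homogForm, star_sub, star_div₀, star_mul', star_pow, star_herm]
  ring

lemma homogMetric_symm (ε : ℤˣ) (r : ℝ) (z ζ ζ' : Fin 3 → ℂ) :
    homogMetric ε r z ζ ζ' = homogMetric ε r z ζ' ζ := by
  rw [homogMetric_eq, homogMetric_eq, ← star_homogForm ε z ζ ζ', Complex.star_def, Complex.conj_re]

lemma homogForm_add_left (ε : ℤˣ) (z a b c : Fin 3 → ℂ) :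
    homogForm ε z (a + b) c = homogForm ε z a c + homogForm ε z b c := by
  simp only [homogForm, herm_add_left]; ring

lemma homogForm_add_right (ε : ℤˣ) (z a b c : Fin 3 → ℂ) :
    homogForm ε z a (b + c) = homogForm ε z a b + homogForm ε z a c := by
  simp only [homogForm, herm_add_right]; ring

lemma homogForm_smul_left (ε : ℤˣ) (z : Fin 3 → ℂ) (c : ℂ) (a b : Fin 3 → ℂ) :
    homogForm ε z (c • a) b = c * homogForm ε z a b := by
  simp only [homogForm, herm_smul_left']; ring

lemma homogForm_smul_right (ε : ℤˣ) (z : Fin 3 → ℂ) (c : ℂ) (a b : Fin 3 → ℂ) :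
    homogForm ε z a (c • b) = star c * homogForm ε z a b := by
  simp only [homogForm, herm_smul_right']; ring

/-- The quotient metric does not change if `z` is rescaled, together with the tangent vectors, or
if multiples of `z` are added to the tangent vectors. -/
lemma homogForm_smul_add {ε : ℤˣ} {z : Fin 3 → ℂ} (hz : herm ε z z ≠ 0) {c : ℂ} (hc : c ≠ 0)
    (a b : ℂ) (ζ ζ' : Fin 3 → ℂ) :
    homogForm ε (c • z) (c • ζ + a • z) (c • ζ' + b • z) = homogForm ε z ζ ζ' := by
  have hc' : star c ≠ 0 := star_ne_zero.2 hc
  simp only [homogForm, herm_add_left, herm_add_right, herm_smul_left', herm_smul_right']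
  field_simp
  ring

/-- The Lagrange identity for the Hermitian form. -/
lemma herm_lagrange (ε : ℤˣ) (z ζ : Fin 3 → ℂ) :
    herm ε z z * herm ε ζ ζ - herm ε ζ z * herm ε z ζ =
      ((((ε : ℤ) : ℝ) * (Complex.normSq (z 0 * ζ 1 - z 1 * ζ 0)
        + Complex.normSq (z 0 * ζ 2 - z 2 * ζ 0)) + Complex.normSq (z 1 * ζ 2 - z 2 * ζ 1) : ℝ)
          : ℂ) := by
  have hε : (((ε : ℤ) : ℂ)) ^ 2 = 1 := by
    rcases Int.units_eq_one_or ε with h | h <;> simp [h]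
  push_cast
  simp only [← Complex.mul_conj, herm, map_sub, map_mul, Complex.star_def]
  linear_combination (0 : ℂ) * hε

lemma lagrange_pos {ε : ℤˣ} {z : Fin 3 → ℂ} (hz : IsAdmissible ε z) (ζ : Fin 3 → ℂ)
    (hζ : ¬ (z 0 * ζ 1 - z 1 * ζ 0 = 0 ∧ z 0 * ζ 2 - z 2 * ζ 0 = 0 ∧ z 1 * ζ 2 - z 2 * ζ 1 = 0)) :
    0 < ((ε : ℤ) : ℝ) * (((ε : ℤ) : ℝ) * (Complex.normSq (z 0 * ζ 1 - z 1 * ζ 0)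
      + Complex.normSq (z 0 * ζ 2 - z 2 * ζ 0)) + Complex.normSq (z 1 * ζ 2 - z 2 * ζ 1)) := by
  set A := z 0 * ζ 1 - z 1 * ζ 0 with hA
  set B := z 0 * ζ 2 - z 2 * ζ 0 with hB
  set C := z 1 * ζ 2 - z 2 * ζ 1 with hC
  have hA0 := Complex.normSq_nonneg A
  have hB0 := Complex.normSq_nonneg B
  have hC0 := Complex.normSq_nonneg C
  rcases Int.units_eq_one_or ε with h | h
  · subst h
    simp only [Units.val_one, Int.cast_one, one_mul]
    by_contra hle
    apply hζ
    refine ⟨Complex.normSq_eq_zero.1 ?_, Complex.normSq_eq_zero.1 ?_,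
      Complex.normSq_eq_zero.1 ?_⟩ <;> linarith
  · subst h
    have hz' : Complex.normSq (z 1) + Complex.normSq (z 2) < Complex.normSq (z 0) := by
      have := hz
      simp [IsAdmissible, herm] at this
      simp only [Complex.normSq_apply]
      linarith
    have hz0 : 0 < Complex.normSq (z 0) :=
      lt_of_le_of_lt (add_nonneg (Complex.normSq_nonneg _) (Complex.normSq_nonneg _)) hz'
    have hne : z 0 ≠ 0 := Complex.normSq_pos.1 hz0
    -- The Plücker relation bounds the third minor by the first two.
    have hpl : z 0 * C = z 1 * B - z 2 * A := by rw [hA, hB, hC]; ring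
    have hcs : Complex.normSq (z 1 * B - z 2 * A) ≤
        (Complex.normSq (z 1) + Complex.normSq (z 2)) * (Complex.normSq A + Complex.normSq B) := by
      have hid : (Complex.normSq (z 1) + Complex.normSq (z 2))
          * (Complex.normSq A + Complex.normSq B) - Complex.normSq (z 1 * B - z 2 * A) =
          Complex.normSq (z 1 * star A + z 2 * star B) := by
        simp only [Complex.normSq_apply, Complex.sub_re, Complex.sub_im, Complex.add_re,
          Complex.add_im, Complex.mul_re, Complex.mul_im, Complex.star_def, Complex.conj_re,
          Complex.conj_im]
        ring
      linarith [Complex.normSq_nonneg (z 1 * star A + z 2 * star B)]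
    rw [← hpl, Complex.normSq_mul] at hcs
    have hAB : 0 < Complex.normSq A + Complex.normSq B := by
      by_contra hle
      have hA1 : Complex.normSq A = 0 := by linarith
      have hB1 : Complex.normSq B = 0 := by linarith
      rw [Complex.normSq_eq_zero] at hA1 hB1
      refine hζ ⟨hA1, hB1, ?_⟩
      rw [hA1, hB1, mul_zero, mul_zero, sub_zero] at hpl
      exact (mul_eq_zero.1 hpl).resolve_left hne
    have hlt : Complex.normSq C < Complex.normSq A + Complex.normSq B := by
      by_contra hge
      have := mul_le_mul_of_nonneg_left (not_lt.1 hge) hz0.le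
      have h3 := mul_lt_mul_of_pos_right hz' hAB
      linarith
    simp only [Units.val_neg, Units.val_one, Int.cast_neg, Int.cast_one]
    linarith

/-- The quotient metric is positive definite on the complement of the line through `z`. -/
lemma homogMetric_pos {ε : ℤˣ} {r : ℝ} (hr : 0 < r) {z : Fin 3 → ℂ} (hz : IsAdmissible ε z)
    (ζ : Fin 3 → ℂ)
    (hζ : ¬ (z 0 * ζ 1 - z 1 * ζ 0 = 0 ∧ z 0 * ζ 2 - z 2 * ζ 0 = 0 ∧ z 1 * ζ 2 - z 2 * ζ 1 = 0)) :
    0 < homogMetric ε r z ζ ζ := by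
  have hN := hz.herm_ne_zero
  have hre : (herm ε z z).re ≠ 0 := fun h => hN (by rw [← ofReal_herm_re, h, Complex.ofReal_zero])
  have h1 : homogForm ε z ζ ζ =
      ((((ε : ℤ) : ℝ) * (Complex.normSq (z 0 * ζ 1 - z 1 * ζ 0)
        + Complex.normSq (z 0 * ζ 2 - z 2 * ζ 0)) + Complex.normSq (z 1 * ζ 2 - z 2 * ζ 1) : ℝ)
          : ℂ) / ((herm ε z z).re ^ 2 : ℝ) := by
    rw [← herm_lagrange, Complex.ofReal_pow, ofReal_herm_re, homogForm]
    field_simp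
  rw [homogMetric_eq, h1, ← Complex.ofReal_div, Complex.ofReal_re, mul_right_comm, ← mul_div_assoc]
  exact mul_pos (div_pos (lagrange_pos hz ζ hζ) (by positivity)) (by positivity)

/-- The metric of the space form in the affine chart `i`, at `w`. -/
noncomputable def chartMetric (ε : ℤˣ) (r : ℝ) (i : Fin 3) (w : Fin 2 → ℂ) :
    (Fin 2 → ℂ) →L[ℝ] (Fin 2 → ℂ) →L[ℝ] ℝ :=
  (isBilinearMap_homogMetric ε r i (homog i 1 w)).toContinuousBilinearMap

lemma chartMetric_apply (ε : ℤˣ) (r : ℝ) (i : Fin 3) (w u v : Fin 2 → ℂ) :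
    chartMetric ε r i w u v = homogMetric ε r (homog i 1 w) (homog i 0 u) (homog i 0 v) := rfl

lemma chartMetric_symm (ε : ℤˣ) (r : ℝ) (i : Fin 3) (w u v : Fin 2 → ℂ) :
    chartMetric ε r i w u v = chartMetric ε r i w v u := homogMetric_symm _ _ _ _ _

lemma chartMetric_I_skew (ε : ℤˣ) (r : ℝ) (i : Fin 3) (w u v : Fin 2 → ℂ) :
    chartMetric ε r i w (Complex.I • u) v = - chartMetric ε r i w u (Complex.I • v) := by
  simp only [chartMetric_apply, homogMetric_eq, homog_complex_smul, homogForm_smul_left,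
    homogForm_smul_right]
  simp

lemma chartMetric_pos {ε : ℤˣ} {r : ℝ} (hr : 0 < r) {i : Fin 3} {w : Fin 2 → ℂ}
    (hw : IsAdmissible ε (homog i 1 w)) {u : Fin 2 → ℂ} (hu : u ≠ 0) :
    0 < chartMetric ε r i w u u := by
  rw [chartMetric_apply]
  refine homogMetric_pos hr hw _ fun h => hu ?_
  have hmin : ∀ l m, homog i 1 w l * homog i 0 u m - homog i 1 w m * homog i 0 u l = 0 := by
    obtain ⟨h1, h2, h3⟩ := h
    intro l m
    fin_cases l <;> fin_cases m <;> dsimp <;> first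
      | ring1
      | linear_combination h1
      | linear_combination h2
      | linear_combination h3
      | linear_combination -h1
      | linear_combination -h2
      | linear_combination -h3
  funext k
  have := hmin i (i.succAbove k)
  simpa using this

lemma isOpen_isAdmissible (ε : ℤˣ) (i : Fin 3) : IsOpen {w | IsAdmissible ε (homog i 1 w)} := by
  have hc : ∀ l, Continuous (fun w : Fin 2 → ℂ => homog i 1 w l) :=
    fun l => (contDiff_homog i l).continuous
  unfold IsAdmissible
  refine isOpen_lt continuous_const ?_
  unfold herm
  have h0 := hc 0
  have h1 := hc 1
  have h2 := hc 2
  fun_prop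

lemma contDiffAt_chartMetric (ε : ℤˣ) (r : ℝ) (i : Fin 3) {w : Fin 2 → ℂ}
    (hw : IsAdmissible ε (homog i 1 w)) : ContDiffAt ℝ ∞ (chartMetric ε r i) w := by
  refine ContDiffOn.contDiffAt ?_ ((isOpen_isAdmissible ε i).mem_nhds hw)
  refine contDiffOn_clm_apply.2 fun u => contDiffOn_clm_apply.2 fun v => ?_
  have hc : ∀ l, ContDiff ℝ ∞ (fun w : Fin 2 → ℂ => homog i 1 w l) := contDiff_homog i
  have hs : ∀ l, ContDiff ℝ ∞ (fun w : Fin 2 → ℂ => star (homog i 1 w l)) := fun l =>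
    Complex.conjCLE.contDiff.comp (hc l)
  have h1 : ContDiff ℝ ∞ (fun w : Fin 2 → ℂ => herm ε (homog i 1 w) (homog i 1 w)) :=
    ((contDiff_const.mul ((hc 0).mul (hs 0))).add ((hc 1).mul (hs 1))).add ((hc 2).mul (hs 2))
  have h2 : ContDiff ℝ ∞ (fun w : Fin 2 → ℂ => herm ε (homog i 0 u) (homog i 1 w)) :=
    ((contDiff_const.mul (contDiff_const.mul (hs 0))).add (contDiff_const.mul (hs 1))).add
      (contDiff_const.mul (hs 2))
  have h3 : ContDiff ℝ ∞ (fun w : Fin 2 → ℂ => herm ε (homog i 1 w) (homog i 0 v)) :=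
    ((contDiff_const.mul ((hc 0).mul contDiff_const)).add ((hc 1).mul contDiff_const)).add
      ((hc 2).mul contDiff_const)
  have h4 : ContDiffOn ℝ ∞ (fun w : Fin 2 → ℂ => (herm ε (homog i 1 w) (homog i 1 w))⁻¹)
      {w | IsAdmissible ε (homog i 1 w)} :=
    h1.contDiffOn.inv fun w hw => IsAdmissible.herm_ne_zero hw
  have h5 : ContDiffOn ℝ ∞ (fun w : Fin 2 → ℂ => homogForm ε (homog i 1 w) (homog i 0 u)
      (homog i 0 v)) {w | IsAdmissible ε (homog i 1 w)} := by
    have := (contDiffOn_const (c := herm ε (homog i 0 u) (homog i 0 v)).mul h4).sub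
      ((h2.mul h3).contDiffOn.mul (h4.pow 2))
    refine this.congr fun w _ => ?_
    simp only [homogForm, div_eq_mul_inv, inv_pow]
  exact contDiffOn_const.mul (Complex.reCLM.contDiff.comp_contDiffOn h5)

lemma isInvertible_chartMetric {ε : ℤˣ} {r : ℝ} (hr : 0 < r) {i : Fin 3} {w : Fin 2 → ℂ}
    (hw : IsAdmissible ε (homog i 1 w)) : (chartMetric ε r i w).IsInvertible :=
  isInvertible_of_posDef fun _ ha => chartMetric_pos hr hw ha

/-- The Christoffel symbols of the space form in the affine chart `i`, in closed form. -/
noncomputable def chartChristoffel (ε : ℤˣ) (i : Fin 3) (w u v : Fin 2 → ℂ) : Fin 2 → ℂ :=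
  -((herm ε (homog i 0 u) (homog i 1 w) / herm ε (homog i 1 w) (homog i 1 w)) • v
    + (herm ε (homog i 0 v) (homog i 1 w) / herm ε (homog i 1 w) (homog i 1 w)) • u)

lemma hasDerivAt_homogForm {ε : ℤˣ} {z : Fin 3 → ℂ} (hz : herm ε z z ≠ 0) (α ζ ζ' : Fin 3 → ℂ) :
    HasDerivAt (fun t : ℝ => homogForm ε (z + t • α) ζ ζ')
      (-(herm ε ζ ζ' * (herm ε α z + herm ε z α) / herm ε z z ^ 2)
        - (herm ε ζ α * herm ε z ζ' + herm ε ζ z * herm ε α ζ') / herm ε z z ^ 2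
        + 2 * (herm ε ζ z * herm ε z ζ') * (herm ε α z + herm ε z α) / herm ε z z ^ 3) 0 := by
  have ht : HasDerivAt (fun t : ℝ => (t : ℂ)) 1 0 := Complex.ofRealCLM.hasDerivAt
  have h1 : HasDerivAt (fun t : ℝ => herm ε ζ (z + t • α)) (herm ε ζ α) 0 := by
    simp only [herm_add_right, herm_smul_right]
    simpa using (ht.mul_const (herm ε ζ α)).const_add (herm ε ζ z)
  have h2 : HasDerivAt (fun t : ℝ => herm ε (z + t • α) ζ') (herm ε α ζ') 0 := by
    simp only [herm_add_left, herm_smul_left]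
    simpa using (ht.mul_const (herm ε α ζ')).const_add (herm ε z ζ')
  have h3 : HasDerivAt (fun t : ℝ => herm ε (z + t • α) (z + t • α))
      (herm ε α z + herm ε z α) 0 := by
    simp only [herm_add_left, herm_add_right, herm_smul_left, herm_smul_right]
    have := (((ht.mul_const (herm ε α z)).const_add (herm ε z z))).add
      ((ht.mul_const (herm ε z α)).add (ht.mul (ht.mul_const (herm ε α α))))
    refine (this.congr_deriv (by simp)).congr_of_eventuallyEq (Eventually.of_forall fun t => ?_)
    simp
    ring
  have hz' : herm ε (z + (0 : ℝ) • α) (z + (0 : ℝ) • α) ≠ 0 := by simpa using hz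
  have h4 := ((hasDerivAt_const (0 : ℝ) (herm ε ζ ζ')).div h3 hz').sub
    ((h1.mul h2).div (h3.pow 2) (pow_ne_zero 2 hz'))
  refine h4.congr_deriv ?_
  simp
  field_simp
  ring

/-- The connection with the symbols `chartChristoffel` is compatible with the metric. -/
lemma fderiv_chartMetric {ε : ℤˣ} {r : ℝ} {i : Fin 3} {w : Fin 2 → ℂ}
    (hw : IsAdmissible ε (homog i 1 w)) (a u v : Fin 2 → ℂ) :
    fderiv ℝ (chartMetric ε r i) w a u v =
      chartMetric ε r i w (chartChristoffel ε i w a u) v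
        + chartMetric ε r i w u (chartChristoffel ε i w a v) := by
  have hd : DifferentiableAt ℝ (chartMetric ε r i) w :=
    (contDiffAt_chartMetric ε r i hw).differentiableAt (by simp)
  have hd' : DifferentiableAt ℝ (fun y => chartMetric ε r i y u v) w :=
    (hd.clm_apply (differentiableAt_const u)).clm_apply (differentiableAt_const v)
  have hN := hw.herm_ne_zero
  rw [fderiv_apply_apply hd, ← hd'.lineDeriv_eq_fderiv]
  have hform := hasDerivAt_homogForm hN (homog i 0 a) (homog i 0 u) (homog i 0 v)
  have hre := (Complex.reCLM.hasFDerivAt.comp_hasDerivAt (0 : ℝ) hform).const_mul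
    (((ε : ℤ) : ℝ) * r ^ 2)
  have hline : (fun t : ℝ => chartMetric ε r i (w + t • a) u v) = fun t : ℝ =>
      ((ε : ℤ) : ℝ) * r ^ 2 * (Complex.reCLM ∘ fun t : ℝ => homogForm ε
        (homog i 1 w + t • homog i 0 a) (homog i 0 u) (homog i 0 v)) t := by
    funext t
    rw [chartMetric_apply, homogMetric_eq, homog_one_add_smul]
    rfl
  rw [lineDeriv, hline, hre.deriv, chartMetric_apply, chartMetric_apply, homogMetric_eq,
    homogMetric_eq, ← mul_add, ← Complex.add_re, Complex.reCLM_apply]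
  congr 2
  have hneg : ∀ c, homog i 0 (-c) = (-1 : ℂ) • homog i 0 c := by
    intro c; rw [← homog_complex_smul]; simp
  simp only [chartChristoffel, hneg, homog_add, homog_complex_smul, homogForm_smul_left,
    homogForm_smul_right, homogForm_add_left, homogForm_add_right, star_div₀, star_herm, star_neg,
    star_one]
  simp only [homogForm]
  field_simp
  ring

lemma christoffel_chartMetric {ε : ℤˣ} {r : ℝ} (hr : 0 < r) {i : Fin 3} {w : Fin 2 → ℂ}
    (hw : IsAdmissible ε (homog i 1 w)) (u v : Fin 2 → ℂ) :
    christoffel (chartMetric ε r i) w u v = chartChristoffel ε i w u v := by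
  have hi := isInvertible_chartMetric hr hw
  have h : chartMetric ε r i w (christoffel (chartMetric ε r i) w u v) =
      chartMetric ε r i w (chartChristoffel ε i w u v) := by
    ext1 b
    rw [apply_christoffel hi]
    refine christoffelLower_eq_of_compatible (chartMetric_symm ε r i w) (fun a b => ?_)
      (fun a b c => fderiv_chartMetric hw a b c) u v b
    simp only [chartChristoffel, add_comm]
  rw [← hi.inverse_apply_self (christoffel _ _ _ _), h, hi.inverse_apply_self]

/-- The complex structure is parallel. -/
lemma christoffel_chartMetric_I {ε : ℤˣ} {r : ℝ} (hr : 0 < r) {i : Fin 3} {w : Fin 2 → ℂ}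
    (hw : IsAdmissible ε (homog i 1 w)) (u v : Fin 2 → ℂ) :
    christoffel (chartMetric ε r i) w u (Complex.I • v) =
      Complex.I • christoffel (chartMetric ε r i) w u v := by
  rw [christoffel_chartMetric hr hw, christoffel_chartMetric hr hw]
  simp only [chartChristoffel, homog_complex_smul, herm_smul_left']
  module

end ChartMetric

/-! ### Affine charts and coordinate changes -/

section AffineCharts

variable {ε : ℤˣ}

/-- The affine chart `i` as a homeomorphism between open sets. -/
noncomputable def affineHomeo (ε : ℤˣ) (i : Fin 3) :
    OpenPartialHomeomorph (SpaceForm ε) (Fin 2 → ℂ) :=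
  (affineAtlas ε).openPartialHomeomorph (affineChart ε i) (Set.mem_range_self i)

lemma affineHomeo_mem_atlas (ε : ℤˣ) (i : Fin 3) :
    affineHomeo ε i ∈ atlas (Fin 2 → ℂ) (SpaceForm ε) := by
  change _ ∈ ⋃ (f : PartialEquiv (SpaceForm ε) (Fin 2 → ℂ)) (hf : f ∈ (affineAtlas ε).atlas),
    {(affineAtlas ε).openPartialHomeomorph f hf}
  simp only [Set.mem_iUnion, Set.mem_singleton_iff]
  exact ⟨_, Set.mem_range_self i, rfl⟩

instance isManifold_one_spaceForm : IsManifold 𝓘(ℝ, Fin 2 → ℂ) 1 (SpaceForm ε) :=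
  IsManifold.of_le (n := ∞) (by simp)

lemma mem_source_chartIndex (L : SpaceForm ε) : L ∈ (affineHomeo ε (chartIndex L)).source :=
  chartIndex_spec L

lemma mem_target_affineHomeo {i : Fin 3} {w : Fin 2 → ℂ} :
    w ∈ (affineHomeo ε i).target ↔ IsAdmissible ε (homog i 1 w) := Iff.rfl

lemma isAdmissible_affineHomeo {i : Fin 3} {L : SpaceForm ε} (hL : L ∈ (affineHomeo ε i).source) :
    IsAdmissible ε (homog i 1 (affineHomeo ε i L)) :=
  (affineHomeo ε i).map_source hL

lemma mdifferentiable_affineHomeo (ε : ℤˣ) (i : Fin 3) :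
    (affineHomeo ε i).MDifferentiable 𝓘(ℝ, Fin 2 → ℂ) 𝓘(ℝ, Fin 2 → ℂ) :=
  mdifferentiable_of_mem_atlas (affineHomeo_mem_atlas ε i)

/-- The coordinate change from the affine chart `i` to the affine chart `j`. -/
noncomputable def coordChange (ε : ℤˣ) (i j : Fin 3) : (Fin 2 → ℂ) → Fin 2 → ℂ :=
  affineHomeo ε j ∘ (affineHomeo ε i).symm

lemma coordChange_apply {i : Fin 3} (j : Fin 3) {w : Fin 2 → ℂ}
    (hw : IsAdmissible ε (homog i 1 w)) :
    coordChange ε i j w = fun k => homog i 1 w (j.succAbove k) / homog i 1 w j :=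
  transition_apply ε i j hw

lemma symm_mem_source_iff {i j : Fin 3} {w : Fin 2 → ℂ} (hw : IsAdmissible ε (homog i 1 w)) :
    (affineHomeo ε i).symm w ∈ (affineHomeo ε j).source ↔ homog i 1 w j ≠ 0 := by
  have h := Set.ext_iff.1 (transition_source ε i j) w
  rw [PartialEquiv.trans_source] at h
  constructor
  · intro hm
    exact (h.1 ⟨hw, hm⟩).2
  · intro hne
    exact (h.2 ⟨hw, hne⟩).2

lemma contDiffAt_coordChange {i j : Fin 3} {w : Fin 2 → ℂ} (hw : IsAdmissible ε (homog i 1 w))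
    (hj : homog i 1 w j ≠ 0) : ContDiffAt ℝ ∞ (coordChange ε i j) w := by
  refine (contDiffOn_transition ε i j).contDiffAt ((isOpen_transition_source ε i j).mem_nhds ?_)
  rw [transition_source]
  exact ⟨hw, hj⟩

lemma homog_coordChange {i j : Fin 3} {w : Fin 2 → ℂ} (hw : IsAdmissible ε (homog i 1 w))
    (hj : homog i 1 w j ≠ 0) :
    homog j 1 (coordChange ε i j w) = (homog i 1 w j)⁻¹ • homog i 1 w := by
  rw [coordChange_apply j hw, homog_quot j _ hj]

/-- The derivative of a coordinate change, in homogeneous coordinates: the tangent vector is rescaled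
by the same factor as the point, up to a multiple of the point. -/
lemma homog_fderiv_coordChange {i j : Fin 3} {w : Fin 2 → ℂ} (hw : IsAdmissible ε (homog i 1 w))
    (hj : homog i 1 w j ≠ 0) (a : Fin 2 → ℂ) :
    homog j 0 (fderiv ℝ (coordChange ε i j) w a) =
      (homog i 1 w j)⁻¹ • homog i 0 a
        + (-(homog i 0 a j / homog i 1 w j ^ 2)) • homog i 1 w := by
  have hd : DifferentiableAt ℝ (coordChange ε i j) w :=
    (contDiffAt_coordChange hw hj).differentiableAt (by simp)
  have hk : ∀ k, fderiv ℝ (coordChange ε i j) w a k =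
      (homog i 0 a (j.succAbove k) * homog i 1 w j - homog i 1 w (j.succAbove k) * homog i 0 a j)
        / homog i 1 w j ^ 2 := by
    intro k
    have hlin : ∀ l, HasDerivAt (fun t : ℝ => homog i 1 (w + t • a) l) (homog i 0 a l) 0 := by
      intro l
      have ht : HasDerivAt (fun t : ℝ => (t : ℂ)) 1 0 := Complex.ofRealCLM.hasDerivAt
      simp only [homog_one_add_smul, Pi.add_apply, Pi.smul_apply, Complex.real_smul]
      simpa using (ht.mul_const (homog i 0 a l)).const_add (homog i 1 w l)
    have hquot : HasDerivAt (fun t : ℝ => coordChange ε i j (w + t • a) k)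
        ((homog i 0 a (j.succAbove k) * homog i 1 w j
          - homog i 1 w (j.succAbove k) * homog i 0 a j) / homog i 1 w j ^ 2) 0 := by
      have h0 : homog i 1 (w + (0 : ℝ) • a) j ≠ 0 := by simpa using hj
      have h1 := (hlin (j.succAbove k)).div (hlin j) h0
      simp only [zero_smul, add_zero] at h1
      refine h1.congr_of_eventuallyEq ?_
      have hcont : ContinuousAt (fun t : ℝ => w + t • a) 0 := by fun_prop
      have hmem : ∀ᶠ y in 𝓝 (w + (0 : ℝ) • a), IsAdmissible ε (homog i 1 y) :=
        (isOpen_isAdmissible ε i).mem_nhds (by simpa using hw)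
      filter_upwards [hcont.eventually hmem] with t ht
      rw [coordChange_apply j ht]
      rfl
    have hline : HasDerivAt (fun t : ℝ => coordChange ε i j (w + t • a))
        (fderiv ℝ (coordChange ε i j) w a) 0 :=
      hd.hasFDerivAt.hasLineDerivAt a
    exact ((hasDerivAt_pi.1 hline) k).unique hquot
  funext l
  rcases Fin.eq_self_or_eq_succAbove j l with rfl | ⟨k, rfl⟩
  · simp only [homog_same, Pi.add_apply, Pi.smul_apply, smul_eq_mul]
    field_simp
    ring
  · simp only [homog_succAbove, hk, Pi.add_apply, Pi.smul_apply, smul_eq_mul]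
    field_simp
    ring

/-- Coordinate changes are isometric. -/
lemma chartMetric_coordChange (r : ℝ) {i j : Fin 3} {w : Fin 2 → ℂ}
    (hw : IsAdmissible ε (homog i 1 w)) (hj : homog i 1 w j ≠ 0) (u v : Fin 2 → ℂ) :
    chartMetric ε r j (coordChange ε i j w) (fderiv ℝ (coordChange ε i j) w u)
      (fderiv ℝ (coordChange ε i j) w v) = chartMetric ε r i w u v := by
  rw [chartMetric_apply, chartMetric_apply, homog_coordChange hw hj,
    homog_fderiv_coordChange hw hj, homog_fderiv_coordChange hw hj, homogMetric_eq, homogMetric_eq,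
    homogForm_smul_add hw.herm_ne_zero (inv_ne_zero hj)]

/-- Coordinate changes are holomorphic. -/
lemma fderiv_coordChange_I {i j : Fin 3} {w : Fin 2 → ℂ} (hw : IsAdmissible ε (homog i 1 w))
    (hj : homog i 1 w j ≠ 0) (u : Fin 2 → ℂ) :
    fderiv ℝ (coordChange ε i j) w (Complex.I • u) =
      Complex.I • fderiv ℝ (coordChange ε i j) w u := by
  have h : homog j 0 (fderiv ℝ (coordChange ε i j) w (Complex.I • u)) =
      homog j 0 (Complex.I • fderiv ℝ (coordChange ε i j) w u) := by
    rw [homog_complex_smul, homog_fderiv_coordChange hw hj, homog_fderiv_coordChange hw hj,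
      homog_complex_smul]
    simp only [Pi.smul_apply, smul_eq_mul]
    module
  funext k
  simpa using congrFun h (j.succAbove k)

/-- The derivative at `L` of the affine chart `i`. -/
noncomputable def chartDeriv (i : Fin 3) (L : SpaceForm ε) : (Fin 2 → ℂ) →L[ℝ] (Fin 2 → ℂ) :=
  mfderiv 𝓘(ℝ, Fin 2 → ℂ) 𝓘(ℝ, Fin 2 → ℂ) (affineHomeo ε i) L

/-- Tangent vectors at `L` are read off in the preferred chart at `L`, so the derivative of the chart
`i` is that of a coordinate change. -/
lemma chartDeriv_eq_fderiv {i : Fin 3} {L : SpaceForm ε} (hL : L ∈ (affineHomeo ε i).source) :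
    chartDeriv i L = fderiv ℝ (coordChange ε (chartIndex L) i)
      (affineHomeo ε (chartIndex L) L) := by
  have hd := (mdifferentiable_affineHomeo ε i).mdifferentiableAt hL
  refine hd.mfderiv.trans ?_
  rw [modelWithCornersSelf_coe, Set.range_id, fderivWithin_univ]
  rfl

lemma homog_affineHomeo_ne_zero {i : Fin 3} {L : SpaceForm ε}
    (hL : L ∈ (affineHomeo ε i).source) (c : Fin 3) (hc : L ∈ (affineHomeo ε c).source) :
    homog c 1 (affineHomeo ε c L) i ≠ 0 := by
  rw [← symm_mem_source_iff (isAdmissible_affineHomeo hc), (affineHomeo ε c).left_inv hc]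
  exact hL

lemma coordChange_affineHomeo {i c : Fin 3} {L : SpaceForm ε}
    (hc : L ∈ (affineHomeo ε c).source) :
    coordChange ε c i (affineHomeo ε c L) = affineHomeo ε i L := by
  rw [coordChange, Function.comp_apply, (affineHomeo ε c).left_inv hc]

/-- The metric of the space form in an arbitrary affine chart. -/
lemma spaceFormMetric_eq (r : ℝ) {i : Fin 3} {L : SpaceForm ε}
    (hL : L ∈ (affineHomeo ε i).source) (u v : Fin 2 → ℂ) :
    spaceFormMetric ε r L u v =
      chartMetric ε r i (affineHomeo ε i L) (chartDeriv i L u) (chartDeriv i L v) := by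
  have hc := mem_source_chartIndex L
  rw [chartDeriv_eq_fderiv hL, ← coordChange_affineHomeo hc,
    chartMetric_coordChange r (isAdmissible_affineHomeo hc) (homog_affineHomeo_ne_zero hL _ hc)]
  rfl

lemma chartDeriv_I {i : Fin 3} {L : SpaceForm ε} (hL : L ∈ (affineHomeo ε i).source)
    (u : Fin 2 → ℂ) : chartDeriv i L (Complex.I • u) = Complex.I • chartDeriv i L u := by
  have hc := mem_source_chartIndex L
  rw [chartDeriv_eq_fderiv hL,
    fderiv_coordChange_I (isAdmissible_affineHomeo hc) (homog_affineHomeo_ne_zero hL _ hc)]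

lemma chartDeriv_chartIndex (L : SpaceForm ε) :
    chartDeriv (chartIndex L) L = ContinuousLinearMap.id ℝ (Fin 2 → ℂ) :=
  mfderiv_extChartAt_self (I := 𝓘(ℝ, Fin 2 → ℂ)) (x := L)

lemma chartDeriv_injective {i : Fin 3} {L : SpaceForm ε} (hL : L ∈ (affineHomeo ε i).source) :
    Function.Injective (chartDeriv i L) :=
  (mdifferentiable_affineHomeo ε i).mfderiv_injective hL

lemma chartDeriv_comp {i c : Fin 3} {L : SpaceForm ε} (hL : L ∈ (affineHomeo ε i).source)
    (hc : L ∈ (affineHomeo ε c).source) (u : Fin 2 → ℂ) :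
    chartDeriv i L u =
      fderiv ℝ (coordChange ε c i) (affineHomeo ε c L) (chartDeriv c L u) := by
  have hd : DifferentiableAt ℝ (coordChange ε c i) (affineHomeo ε c L) :=
    (contDiffAt_coordChange (isAdmissible_affineHomeo hc)
      (homog_affineHomeo_ne_zero hL _ hc)).differentiableAt (by simp)
  have h1 : (affineHomeo ε i : SpaceForm ε → Fin 2 → ℂ) =ᶠ[𝓝 L]
      coordChange ε c i ∘ affineHomeo ε c := by
    filter_upwards [(affineHomeo ε c).open_source.mem_nhds hc] with L' hL'
    exact (coordChange_affineHomeo hL').symm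
  have h2 : mfderiv 𝓘(ℝ, Fin 2 → ℂ) 𝓘(ℝ, Fin 2 → ℂ) (affineHomeo ε i) L =
      mfderiv 𝓘(ℝ, Fin 2 → ℂ) 𝓘(ℝ, Fin 2 → ℂ) (coordChange ε c i ∘ affineHomeo ε c) L :=
    h1.mfderiv_eq
  have h3 := mfderiv_comp L hd.mdifferentiableAt
    ((mdifferentiable_affineHomeo ε c).mdifferentiableAt hc)
  rw [mfderiv_eq_fderiv] at h3
  rw [chartDeriv, h2, h3]
  rfl

/-- The metric coefficients that enter the covariant derivative are those of `chartMetric`. -/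
lemma metricInChart_spaceFormMetric (r : ℝ) (L : SpaceForm ε) {w : Fin 2 → ℂ}
    (hw : IsAdmissible ε (homog (chartIndex L) 1 w)) :
    metricInChart (spaceFormMetric ε r) L w = chartMetric ε r (chartIndex L) w := by
  ext1 u
  ext1 v
  set i := chartIndex L with hi
  have hL' : (affineHomeo ε i).symm w ∈ (affineHomeo ε i).source :=
    (affineHomeo ε i).map_target (mem_target_affineHomeo.2 hw)
  have hcomp := (mdifferentiable_affineHomeo ε i).comp_symm_deriv (mem_target_affineHomeo.2 hw)
  have h1 : metricInChart (spaceFormMetric ε r) L w u v =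
      spaceFormMetric ε r ((affineHomeo ε i).symm w)
        (mfderiv 𝓘(ℝ, Fin 2 → ℂ) 𝓘(ℝ, Fin 2 → ℂ) (affineHomeo ε i).symm w u)
        (mfderiv 𝓘(ℝ, Fin 2 → ℂ) 𝓘(ℝ, Fin 2 → ℂ) (affineHomeo ε i).symm w v) := rfl
  have h2 : ∀ a : Fin 2 → ℂ, chartDeriv i ((affineHomeo ε i).symm w)
      (mfderiv 𝓘(ℝ, Fin 2 → ℂ) 𝓘(ℝ, Fin 2 → ℂ) (affineHomeo ε i).symm w a) = a := fun a =>
    congrArg (fun T => T a) hcomp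
  rw [h1]
  refine (spaceFormMetric_eq r hL' _ _).trans ?_
  rw [(affineHomeo ε i).right_inv (mem_target_affineHomeo.2 hw)]
  exact congrArg₂ (fun a b => chartMetric ε r i w a b) (h2 u) (h2 v)

end AffineCharts

/-! ### Covariant derivatives along a map into the space form -/

section CovariantDerivative

variable {ε : ℤˣ} {E : Type*} [NormedAddCommGroup E] [NormedSpace ℝ E]
  {M : Type*} [TopologicalSpace M] [ChartedSpace E M]

/-- The derivative of a map between manifolds, with its type read off in the preferred charts. -/
noncomputable def differential {E' : Type*} [NormedAddCommGroup E'] [NormedSpace ℝ E']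
    {X : Type*} [TopologicalSpace X] [ChartedSpace E' X] (f : M → X) (p : M) : E →L[ℝ] E' :=
  mfderiv 𝓘(ℝ, E) 𝓘(ℝ, E') f p

lemma hasFDerivAt_differential {F : Type*} [NormedAddCommGroup F] [NormedSpace ℝ F] {f : M → F}
    {p : M} (hf : MDifferentiableAt 𝓘(ℝ, E) 𝓘(ℝ, F) f p) :
    HasFDerivAt (f ∘ (extChartAt 𝓘(ℝ, E) p).symm) (differential (E := E) f p)
      (extChartAt 𝓘(ℝ, E) p p) := by
  have h : HasFDerivWithinAt (f ∘ (extChartAt 𝓘(ℝ, E) p).symm) (differential (E := E) f p)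
      (Set.range 𝓘(ℝ, E)) (extChartAt 𝓘(ℝ, E) p p) := hf.hasMFDerivAt.2
  rwa [modelWithCornersSelf_coe, Set.range_id, hasFDerivWithinAt_univ] at h

/-- A vector field along `Φ`, in the affine chart `i`. -/
noncomputable def vecInChart {M : Type*} (i : Fin 3) (Φ : M → SpaceForm ε)
    (ξ : ∀ p, TangentSpace 𝓘(ℝ, Fin 2 → ℂ) (Φ p)) (p : M) : Fin 2 → ℂ :=
  chartDeriv i (Φ p) (ξ p)

lemma vecInChart_chartIndex {M : Type*} (Φ : M → SpaceForm ε)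
    (ξ : ∀ p, TangentSpace 𝓘(ℝ, Fin 2 → ℂ) (Φ p)) (p : M) :
    vecInChart (chartIndex (Φ p)) Φ ξ p = ξ p := by
  rw [vecInChart, chartDeriv_chartIndex]
  rfl

lemma trivializationAt_snd (L₀ : SpaceForm ε) {L : SpaceForm ε}
    (hL : L ∈ (affineHomeo ε (chartIndex L₀)).source) (v : TangentSpace 𝓘(ℝ, Fin 2 → ℂ) L) :
    (trivializationAt (Fin 2 → ℂ) (TangentSpace 𝓘(ℝ, Fin 2 → ℂ)) L₀ ⟨L, v⟩).2 =
      chartDeriv (chartIndex L₀) L v := by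
  have hb : L ∈ (trivializationAt (Fin 2 → ℂ) (TangentSpace 𝓘(ℝ, Fin 2 → ℂ)) L₀).baseSet := hL
  have h1 : (trivializationAt (Fin 2 → ℂ) (TangentSpace 𝓘(ℝ, Fin 2 → ℂ)) L₀).continuousLinearMapAt
      ℝ L v = (trivializationAt (Fin 2 → ℂ) (TangentSpace 𝓘(ℝ, Fin 2 → ℂ)) L₀ ⟨L, v⟩).2 := by
    rw [Bundle.Trivialization.continuousLinearMapAt_apply,
      Bundle.Trivialization.linearMapAt_apply, if_pos hb]
  rw [← h1]
  exact congrArg (fun T => T v)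
    (TangentBundle.continuousLinearMapAt_trivializationAt (I := 𝓘(ℝ, Fin 2 → ℂ)) hL)

lemma eventually_mem_source {Φ : M → SpaceForm ε} {p : M} (hΦ : ContinuousAt Φ p) {i : Fin 3}
    (hi : Φ p ∈ (affineHomeo ε i).source) : ∀ᶠ p' in 𝓝 p, Φ p' ∈ (affineHomeo ε i).source :=
  hΦ.eventually ((affineHomeo ε i).open_source.mem_nhds hi)

lemma contMDiffAt_affineHomeo_comp {Φ : M → SpaceForm ε} {p : M}
    (hΦ : ContMDiffAt 𝓘(ℝ, E) 𝓘(ℝ, Fin 2 → ℂ) ∞ Φ p) {i : Fin 3}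
    (hi : Φ p ∈ (affineHomeo ε i).source) :
    ContMDiffAt 𝓘(ℝ, E) 𝓘(ℝ, Fin 2 → ℂ) ∞ (fun p' => affineHomeo ε i (Φ p')) p := by
  have h : ContMDiffAt 𝓘(ℝ, Fin 2 → ℂ) 𝓘(ℝ, Fin 2 → ℂ) ∞ (affineHomeo ε i) (Φ p) :=
    (contMDiffOn_of_mem_maximalAtlas (IsManifold.subset_maximalAtlas
      (affineHomeo_mem_atlas ε i))).contMDiffAt ((affineHomeo ε i).open_source.mem_nhds hi)
  exact h.comp p hΦ

/-- The change of charts for vector fields along `Φ`. -/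
lemma vecInChart_eventuallyEq {Φ : M → SpaceForm ε} {p : M} (hΦ : ContinuousAt Φ p)
    (ξ : ∀ p, TangentSpace 𝓘(ℝ, Fin 2 → ℂ) (Φ p)) {i c : Fin 3}
    (hi : Φ p ∈ (affineHomeo ε i).source) (hc : Φ p ∈ (affineHomeo ε c).source) :
    vecInChart i Φ ξ =ᶠ[𝓝 p] fun p' =>
      fderiv ℝ (coordChange ε c i) (affineHomeo ε c (Φ p')) (vecInChart c Φ ξ p') := by
  filter_upwards [eventually_mem_source hΦ hi, eventually_mem_source hΦ hc] with p' h1 h2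
  exact chartDeriv_comp h1 h2 _

/-- The components of a smooth field in an affine chart are smooth. In the preferred chart they are
the components in the trivialization of the tangent bundle. -/
lemma contMDiffAt_vecInChart {Φ : M → SpaceForm ε} {p : M}
    {ξ : ∀ p, TangentSpace 𝓘(ℝ, Fin 2 → ℂ) (Φ p)}
    (hξ : ContMDiffAt 𝓘(ℝ, E) 𝓘(ℝ, Fin 2 → ℂ).tangent ∞
      (fun p => (⟨Φ p, ξ p⟩ : TangentBundle 𝓘(ℝ, Fin 2 → ℂ) (SpaceForm ε))) p) {i : Fin 3}
    (hi : Φ p ∈ (affineHomeo ε i).source) :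
    ContMDiffAt 𝓘(ℝ, E) 𝓘(ℝ, Fin 2 → ℂ) ∞ (vecInChart i Φ ξ) p := by
  obtain ⟨hΦ, hsnd⟩ := Bundle.contMDiffAt_totalSpace.1 hξ
  have hΦ' : ContMDiffAt 𝓘(ℝ, E) 𝓘(ℝ, Fin 2 → ℂ) ∞ Φ p := hΦ
  have hc := mem_source_chartIndex (Φ p)
  have h1 : ContMDiffAt 𝓘(ℝ, E) 𝓘(ℝ, Fin 2 → ℂ) ∞ (vecInChart (chartIndex (Φ p)) Φ ξ) p := by
    refine hsnd.congr_of_eventuallyEq ?_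
    filter_upwards [eventually_mem_source hΦ'.continuousAt hc] with p' hp'
    exact (trivializationAt_snd (Φ p) hp' (ξ p')).symm
  refine ContMDiffAt.congr_of_eventuallyEq ?_ (vecInChart_eventuallyEq hΦ'.continuousAt ξ hi hc)
  have h2 : ContDiffAt ℝ ∞ (fderiv ℝ (coordChange ε (chartIndex (Φ p)) i))
      (affineHomeo ε (chartIndex (Φ p)) (Φ p)) :=
    (contDiffAt_coordChange (isAdmissible_affineHomeo hc)
      (homog_affineHomeo_ne_zero hi _ hc)).fderiv_right (m := ∞) (by simp)
  have h3 : ContMDiffAt 𝓘(ℝ, E) 𝓘(ℝ, (Fin 2 → ℂ) →L[ℝ] (Fin 2 → ℂ)) ∞ (fun p' =>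
      fderiv ℝ (coordChange ε (chartIndex (Φ p)) i) (affineHomeo ε (chartIndex (Φ p)) (Φ p'))) p :=
    h2.contMDiffAt.comp p (contMDiffAt_affineHomeo_comp hΦ' hc)
  exact h3.clm_apply h1

lemma differential_affineHomeo_comp {Φ : M → SpaceForm ε} {p : M}
    (hΦ : MDifferentiableAt 𝓘(ℝ, E) 𝓘(ℝ, Fin 2 → ℂ) Φ p) {i : Fin 3}
    (hi : Φ p ∈ (affineHomeo ε i).source) (v : E) :
    differential (E := E) (fun p' => affineHomeo ε i (Φ p')) p v =
      chartDeriv i (Φ p) (differential (E := E) Φ p v) :=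
  congrArg (fun T => T v)
    (mfderiv_comp p ((mdifferentiable_affineHomeo ε i).mdifferentiableAt hi) hΦ)

/-- The covariant derivative along `Φ`, with its value read off in the preferred chart. -/
noncomputable def covDeriv (r : ℝ) (Φ : M → SpaceForm ε)
    (ξ : ∀ p, TangentSpace 𝓘(ℝ, Fin 2 → ℂ) (Φ p)) (p : M) (v : E) : Fin 2 → ℂ :=
  covDerivAlong (spaceFormMetric ε r) Φ ξ p v

lemma covDeriv_chartIndex (r : ℝ) {Φ : M → SpaceForm ε} {p : M}
    (hΦ : ContinuousAt Φ p) (ξ : ∀ p, TangentSpace 𝓘(ℝ, Fin 2 → ℂ) (Φ p)) (v : E) :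
    covDeriv r Φ ξ p v =
      differential (E := E) (vecInChart (chartIndex (Φ p)) Φ ξ) p v
        + christoffel (chartMetric ε r (chartIndex (Φ p))) (affineHomeo ε (chartIndex (Φ p)) (Φ p))
          (differential (E := E) Φ p v) (vecInChart (chartIndex (Φ p)) Φ ξ p) := by
  have hc := mem_source_chartIndex (Φ p)
  have h1 : (fun p' => (trivializationAt (Fin 2 → ℂ) (TangentSpace 𝓘(ℝ, Fin 2 → ℂ)) (Φ p)
      ⟨Φ p', ξ p'⟩).2) =ᶠ[𝓝 p] vecInChart (chartIndex (Φ p)) Φ ξ := by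
    filter_upwards [eventually_mem_source hΦ hc] with p' hp'
    exact trivializationAt_snd (Φ p) hp' (ξ p')
  have h2 : metricInChart (spaceFormMetric ε r) (Φ p) =ᶠ[𝓝 (affineHomeo ε (chartIndex (Φ p)) (Φ p))]
      chartMetric ε r (chartIndex (Φ p)) := by
    filter_upwards [(isOpen_isAdmissible ε (chartIndex (Φ p))).mem_nhds
      (isAdmissible_affineHomeo hc)] with w hw
    exact metricInChart_spaceFormMetric r (Φ p) hw
  have h3 : differential (E := E) (fun p' => (trivializationAt (Fin 2 → ℂ)
      (TangentSpace 𝓘(ℝ, Fin 2 → ℂ)) (Φ p) ⟨Φ p', ξ p'⟩).2) p =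
      differential (E := E) (vecInChart (chartIndex (Φ p)) Φ ξ) p :=
    Filter.EventuallyEq.mfderiv_eq (I := 𝓘(ℝ, E)) (I' := 𝓘(ℝ, Fin 2 → ℂ)) h1
  have h4 := christoffel_congr h2
  change differential (E := E) (fun p' => (trivializationAt (Fin 2 → ℂ)
      (TangentSpace 𝓘(ℝ, Fin 2 → ℂ)) (Φ p) ⟨Φ p', ξ p'⟩).2) p v
      + christoffel (metricInChart (spaceFormMetric ε r) (Φ p))
        (affineHomeo ε (chartIndex (Φ p)) (Φ p)) (differential (E := E) Φ p v)
        (show Fin 2 → ℂ from ξ p) = _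
  rw [h3, h4, ← vecInChart_chartIndex Φ ξ p]

/-- The covariant derivative along `Φ` can be computed in any affine chart. -/
theorem chartDeriv_covDeriv {r : ℝ} (hr : 0 < r) {Φ : M → SpaceForm ε} {p : M}
    {ξ : ∀ p, TangentSpace 𝓘(ℝ, Fin 2 → ℂ) (Φ p)}
    (hξ : ContMDiffAt 𝓘(ℝ, E) 𝓘(ℝ, Fin 2 → ℂ).tangent ∞
      (fun p => (⟨Φ p, ξ p⟩ : TangentBundle 𝓘(ℝ, Fin 2 → ℂ) (SpaceForm ε))) p) {i : Fin 3}
    (hi : Φ p ∈ (affineHomeo ε i).source) (v : E) :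
    chartDeriv i (Φ p) (covDeriv r Φ ξ p v) =
      differential (E := E) (vecInChart i Φ ξ) p v
        + christoffel (chartMetric ε r i) (affineHomeo ε i (Φ p))
          (differential (E := E) (fun p' => affineHomeo ε i (Φ p')) p v) (vecInChart i Φ ξ p) := by
  have hΦ : ContMDiffAt 𝓘(ℝ, E) 𝓘(ℝ, Fin 2 → ℂ) ∞ Φ p :=
    (Bundle.contMDiffAt_totalSpace.1 hξ).1
  have hc := mem_source_chartIndex (Φ p)
  rw [covDeriv_chartIndex r hΦ.continuousAt]
  set c := chartIndex (Φ p) with hcdef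
  have hadm := isAdmissible_affineHomeo hc
  have hne := homog_affineHomeo_ne_zero hi c hc
  have hΦd : MDifferentiableAt 𝓘(ℝ, E) 𝓘(ℝ, Fin 2 → ℂ) Φ p := hΦ.mdifferentiableAt (by simp)
  have hτ := contDiffAt_coordChange hadm hne
  -- Differentiate the change of charts `ξ_i = Dτ (ξ_c)` along `Φ`.
  have hdiff : differential (E := E) (vecInChart i Φ ξ) p v =
      fderiv ℝ (fderiv ℝ (coordChange ε c i)) (affineHomeo ε c (Φ p))
        (differential (E := E) (fun p' => affineHomeo ε c (Φ p')) p v) (vecInChart c Φ ξ p)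
      + fderiv ℝ (coordChange ε c i) (affineHomeo ε c (Φ p))
        (differential (E := E) (vecInChart c Φ ξ) p v) := by
    have hx : (extChartAt 𝓘(ℝ, E) p).symm (extChartAt 𝓘(ℝ, E) p p) = p :=
      extChartAt_to_inv p
    have h1 := hasFDerivAt_differential
      ((contMDiffAt_vecInChart hξ hi).mdifferentiableAt (by simp))
    have h2 := hasFDerivAt_differential
      ((contMDiffAt_vecInChart hξ hc).mdifferentiableAt (by simp))
    have h3 := hasFDerivAt_differential
      ((contMDiffAt_affineHomeo_comp hΦ hc).mdifferentiableAt (by simp))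
    have h4 : HasFDerivAt (fderiv ℝ (coordChange ε c i))
        (fderiv ℝ (fderiv ℝ (coordChange ε c i)) (affineHomeo ε c (Φ p)))
        (((fun p' => affineHomeo ε c (Φ p')) ∘ (extChartAt 𝓘(ℝ, E) p).symm)
          (extChartAt 𝓘(ℝ, E) p p)) := by
      rw [Function.comp_apply, hx]
      exact ((hτ.fderiv_right (m := 1) (by norm_cast)).differentiableAt (by norm_num)).hasFDerivAt
    have h5 := (h4.comp _ h3).clm_apply h2
    have h6 : vecInChart i Φ ξ ∘ (extChartAt 𝓘(ℝ, E) p).symm =ᶠ[𝓝 (extChartAt 𝓘(ℝ, E) p p)]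
        fun y => fderiv ℝ (coordChange ε c i)
          (((fun p' => affineHomeo ε c (Φ p')) ∘ (extChartAt 𝓘(ℝ, E) p).symm) y)
          ((vecInChart c Φ ξ ∘ (extChartAt 𝓘(ℝ, E) p).symm) y) := by
      have hcont : Tendsto (extChartAt 𝓘(ℝ, E) p).symm (𝓝 (extChartAt 𝓘(ℝ, E) p p)) (𝓝 p) := by
        have := continuousAt_extChartAt_symm (I := 𝓘(ℝ, E)) p
        rwa [ContinuousAt, hx] at this
      exact hcont.eventually (vecInChart_eventuallyEq hΦ.continuousAt ξ hi hc)
    have h7 := congrArg (fun T => T v) (h1.unique (h5.congr_of_eventuallyEq h6))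
    simpa [hx, add_comm] using h7
  have hpull : ∀ᶠ y in 𝓝 (affineHomeo ε c (Φ p)), ∀ a b, chartMetric ε r c y a b =
      chartMetric ε r i (coordChange ε c i y) (fderiv ℝ (coordChange ε c i) y a)
        (fderiv ℝ (coordChange ε c i) y b) := by
    have hcont : ContinuousAt (fun y : Fin 2 → ℂ => homog c 1 y i) (affineHomeo ε c (Φ p)) :=
      (contDiff_homog c i).continuous.continuousAt
    filter_upwards [(isOpen_isAdmissible ε c).mem_nhds hadm, hcont.eventually_ne hne]
      with y h1 h2 a b
    exact (chartMetric_coordChange r h1 h2 a b).symm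
  have himg := coordChange_affineHomeo (i := i) hc
  have hadm' := isAdmissible_affineHomeo hi
  have hDc : ∀ u, chartDeriv i (Φ p) u =
      fderiv ℝ (coordChange ε c i) (affineHomeo ε c (Φ p)) u := by
    intro u
    rw [chartDeriv_eq_fderiv hi]
  have hinvT : Function.Bijective (fderiv ℝ (coordChange ε c i) (affineHomeo ε c (Φ p))) := by
    have := (mdifferentiable_affineHomeo ε i).mfderiv_bijective hi
    rw [← chartDeriv_eq_fderiv hi]
    exact this
  set T := fderiv ℝ (coordChange ε c i) (affineHomeo ε c (Φ p)) with hT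
  -- The transformation rule of the Christoffel symbols.
  have hΓ : ∀ u n, T (christoffel (chartMetric ε r c) (affineHomeo ε c (Φ p)) u n) =
      christoffel (chartMetric ε r i) (affineHomeo ε i (Φ p)) (T u) (T n)
        + fderiv ℝ (fderiv ℝ (coordChange ε c i)) (affineHomeo ε c (Φ p)) u n := by
    intro u n
    have hi' := isInvertible_chartMetric hr hadm'
    have hc' := isInvertible_chartMetric hr hadm
    have h : chartMetric ε r i (affineHomeo ε i (Φ p))
        (T (christoffel (chartMetric ε r c) (affineHomeo ε c (Φ p)) u n)) =
        chartMetric ε r i (affineHomeo ε i (Φ p))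
          (christoffel (chartMetric ε r i) (affineHomeo ε i (Φ p)) (T u) (T n)
        + fderiv ℝ (fderiv ℝ (coordChange ε c i)) (affineHomeo ε c (Φ p)) u n) := by
      ext1 b'
      obtain ⟨b, rfl⟩ := hinvT.2 b'
      have h1 := christoffelLower_of_pullback (hτ.of_le (by norm_cast))
        ((contDiffAt_chartMetric ε r i (by rw [himg]; exact hadm')).of_le (by norm_cast))
        (chartMetric_symm ε r i _) hpull u n b
      have h2 := hpull.self_of_nhds (christoffel (chartMetric ε r c) (affineHomeo ε c (Φ p)) u n) b
      rw [apply_christoffel hc', himg] at h2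
      rw [himg] at h1
      rw [← hT] at h1 h2
      rw [← h2, h1, map_add, add_apply, apply_christoffel hi']
    rw [← hi'.inverse_apply_self (T _), h, hi'.inverse_apply_self]
  have hn : vecInChart i Φ ξ p = T (vecInChart c Φ ξ p) := chartDeriv_comp hi hc _
  have hu : ∀ v, differential (E := E) (fun p' => affineHomeo ε c (Φ p')) p v =
      differential (E := E) (E' := Fin 2 → ℂ) Φ p v := by
    intro v
    rw [differential_affineHomeo_comp hΦd hc, hcdef, chartDeriv_chartIndex]
    rfl
  rw [hdiff, hn, hDc, map_add, hΓ, differential_affineHomeo_comp hΦd hi, hDc, hu]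
  abel

end CovariantDerivative

/-! ### Unit normals and the distribution `ℋ` -/

section UnitNormals

-- Instances on nested spaces of continuous linear maps exceed the default search bounds.
set_option synthInstance.maxHeartbeats 200000
set_option maxSynthPendingDepth 3

/-- A hyperplane orthogonal to a unit vector `n` contains every vector orthogonal to `n`, by a count
of dimensions. -/
lemma exists_of_orthogonal_normal {T : EuclideanSpace ℝ (Fin 3) →L[ℝ] (Fin 2 → ℂ)}
    (hT : Function.Injective T) {g : (Fin 2 → ℂ) →L[ℝ] (Fin 2 → ℂ) →L[ℝ] ℝ} {n : Fin 2 → ℂ}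
    (hn : g n n = 1) (hnT : ∀ v, g n (T v) = 0) {η : Fin 2 → ℂ} (hη : g n η = 0) :
    ∃ v, T v = η := by
  let ℓ : (Fin 2 → ℂ) →ₗ[ℝ] ℝ := (g n : (Fin 2 → ℂ) →ₗ[ℝ] ℝ)
  let T' : EuclideanSpace ℝ (Fin 3) →ₗ[ℝ] (Fin 2 → ℂ) := T
  have hle : LinearMap.range T' ≤ LinearMap.ker ℓ := by
    rintro _ ⟨v, rfl⟩
    exact hnT v
  have h1 : Module.finrank ℝ (LinearMap.range T') = 3 := by
    rw [LinearMap.finrank_range_of_inj hT]; simp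
  have hsurj : LinearMap.range ℓ = ⊤ := by
    rw [LinearMap.range_eq_top]
    intro t
    exact ⟨t • n, by simp [ℓ, hn]⟩
  have h2 := LinearMap.finrank_range_add_finrank_ker ℓ
  have h3 : Module.finrank ℝ (Fin 2 → ℂ) = 4 := by
    rw [Module.finrank_pi_fintype]
    simp
  rw [hsurj, finrank_top, Module.finrank_self, h3] at h2
  have heq := Submodule.eq_of_le_of_finrank_eq hle (by omega)
  have hmem : η ∈ LinearMap.ker ℓ := hη
  rw [← heq] at hmem
  exact hmem

variable {ε : ℤˣ} {r : ℝ}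
  {M : Type*} [TopologicalSpace M] [ChartedSpace (EuclideanSpace ℝ (Fin 3)) M]
  {Φ : M → SpaceForm ε} {ξ ξ' : ∀ p, TangentSpace 𝓘(ℝ, Fin 2 → ℂ) (Φ p)} {U U' : Set M} {p : M}

/-- The metric at a point of the space form, read off in the preferred chart. -/
noncomputable def metricAt (r : ℝ) (L : SpaceForm ε) : (Fin 2 → ℂ) →L[ℝ] (Fin 2 → ℂ) →L[ℝ] ℝ :=
  chartMetric ε r (chartIndex L) (affineHomeo ε (chartIndex L) L)

lemma metricAt_pos (hr : 0 < r) (L : SpaceForm ε) {u : Fin 2 → ℂ} (hu : u ≠ 0) :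
    0 < metricAt r L u u :=
  chartMetric_pos hr (isAdmissible_affineHomeo (mem_source_chartIndex L)) hu

/-- The normal vector at `p`, read off in the preferred chart. -/
noncomputable def normalAt {M : Type*} {Φ : M → SpaceForm ε}
    (ξ : ∀ p, TangentSpace 𝓘(ℝ, Fin 2 → ℂ) (Φ p)) (p : M) : Fin 2 → ℂ :=
  ξ p

lemma vecInChart_eq_normalAt {M : Type*} {Φ : M → SpaceForm ε}
    (ξ : ∀ p, TangentSpace 𝓘(ℝ, Fin 2 → ℂ) (Φ p)) (p : M) :
    vecInChart (chartIndex (Φ p)) Φ ξ p = normalAt ξ p := vecInChart_chartIndex Φ ξ p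

lemma IsUnitNormalOn.contMDiffAt (hξ : IsUnitNormalOn ε r Φ ξ U) (hp : p ∈ U) :
    ContMDiffAt (𝓡 3) 𝓘(ℝ, Fin 2 → ℂ).tangent ∞
      (fun p => (⟨Φ p, ξ p⟩ : TangentBundle 𝓘(ℝ, Fin 2 → ℂ) (SpaceForm ε))) p :=
  hξ.2.1.contMDiffAt (hξ.1.mem_nhds hp)

lemma IsUnitNormalOn.metricAt_self (hξ : IsUnitNormalOn ε r Φ ξ U) (hp : p ∈ U) :
    metricAt r (Φ p) (normalAt ξ p) (normalAt ξ p) = 1 := (hξ.2.2 p hp).1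

lemma IsUnitNormalOn.metricAt_differential (hξ : IsUnitNormalOn ε r Φ ξ U) (hp : p ∈ U)
    (v : EuclideanSpace ℝ (Fin 3)) :
    metricAt r (Φ p) (normalAt ξ p) (differential Φ p v) = 0 := (hξ.2.2 p hp).2 v

lemma IsUnitNormalOn.exists_differential_eq (hξ : IsUnitNormalOn ε r Φ ξ U) (hp : p ∈ U)
    (hinj : Function.Injective (differential (E := EuclideanSpace ℝ (Fin 3)) (E' := Fin 2 → ℂ) Φ p))
    {η : Fin 2 → ℂ} (hη : metricAt r (Φ p) (normalAt ξ p) η = 0) :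
    ∃ v : EuclideanSpace ℝ (Fin 3), differential Φ p v = η :=
  exists_of_orthogonal_normal hinj (hξ.metricAt_self hp) (hξ.metricAt_differential hp) hη

lemma differential_tangentPreimage {η : Fin 2 → ℂ}
    (h : ∃ v : EuclideanSpace ℝ (Fin 3), differential Φ p v = η) :
    differential (E := EuclideanSpace ℝ (Fin 3)) (E' := Fin 2 → ℂ) Φ p
      (tangentPreimage Φ p η) = η :=
  Function.invFun_eq h

/-- The structure vector at `p`, read off in the preferred chart. -/
noncomputable def structVec (Φ : M → SpaceForm ε)
    (ξ : ∀ p, TangentSpace 𝓘(ℝ, Fin 2 → ℂ) (Φ p)) (p : M) : EuclideanSpace ℝ (Fin 3) :=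
  structureVector Φ ξ p

/-- The shape operator at `p`, read off in the preferred chart. -/
noncomputable def shapeOp (r : ℝ) (Φ : M → SpaceForm ε)
    (ξ : ∀ p, TangentSpace 𝓘(ℝ, Fin 2 → ℂ) (Φ p)) (p : M) (v : EuclideanSpace ℝ (Fin 3)) :
    EuclideanSpace ℝ (Fin 3) :=
  shapeOperator ε r Φ ξ p v

/-- The distribution `ℋ` at `p`, read off in the preferred chart. -/
noncomputable def hopfSpace (r : ℝ) (Φ : M → SpaceForm ε) (p : M) :
    Submodule ℝ (EuclideanSpace ℝ (Fin 3)) :=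
  hopfDistribution ε r Φ p

/-- `dΦ(W) = -J ξ`. -/
lemma IsUnitNormalOn.differential_structVec (hξ : IsUnitNormalOn ε r Φ ξ U) (hp : p ∈ U)
    (hinj : Function.Injective
      (differential (E := EuclideanSpace ℝ (Fin 3)) (E' := Fin 2 → ℂ) Φ p)) :
    differential (E := EuclideanSpace ℝ (Fin 3)) (E' := Fin 2 → ℂ) Φ p (structVec Φ ξ p) =
      -(Complex.I • normalAt ξ p) := by
  have h1 := chartMetric_I_skew ε r (chartIndex (Φ p)) (affineHomeo ε (chartIndex (Φ p)) (Φ p))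
    (normalAt ξ p) (normalAt ξ p)
  rw [chartMetric_symm] at h1
  have h2 : metricAt r (Φ p) (normalAt ξ p) (-(Complex.I • normalAt ξ p)) = 0 := by
    rw [map_neg, metricAt]
    linarith
  exact differential_tangentPreimage (hξ.exists_differential_eq hp hinj h2)

/-- The covariant derivative of a unit normal field is tangent to the hypersurface, because the
connection is compatible with the metric. -/
lemma IsUnitNormalOn.metricAt_covDeriv (hr : 0 < r) (hξ : IsUnitNormalOn ε r Φ ξ U) (hp : p ∈ U)
    (v : EuclideanSpace ℝ (Fin 3)) :
    metricAt r (Φ p) (normalAt ξ p) (covDeriv r Φ ξ p v) = 0 := by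
  have hsm := hξ.contMDiffAt hp
  have hΦ : ContMDiffAt (𝓡 3) 𝓘(ℝ, Fin 2 → ℂ) ∞ Φ p :=
    (Bundle.contMDiffAt_totalSpace.1 hsm).1
  have hΦd : MDifferentiableAt (𝓡 3) 𝓘(ℝ, Fin 2 → ℂ) Φ p := hΦ.mdifferentiableAt (by simp)
  have hc := mem_source_chartIndex (Φ p)
  have hadm := isAdmissible_affineHomeo hc
  have hn := vecInChart_eq_normalAt ξ p
  have hcov := covDeriv_chartIndex r hΦ.continuousAt ξ v
  have hu : differential (E := EuclideanSpace ℝ (Fin 3))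
      (fun p' => affineHomeo ε (chartIndex (Φ p)) (Φ p')) p v =
      differential (E := EuclideanSpace ℝ (Fin 3)) (E' := Fin 2 → ℂ) Φ p v := by
    rw [differential_affineHomeo_comp hΦd hc, chartDeriv_chartIndex]
    rfl
  rw [hcov, metricAt, ← hn]
  clear hcov
  set c := chartIndex (Φ p) with hcdef
  rw [← hu]
  have hx : (extChartAt (𝓡 3) p).symm (extChartAt (𝓡 3) p p) = p := extChartAt_to_inv p
  have h2 := hasFDerivAt_differential
    ((contMDiffAt_vecInChart hsm hc).mdifferentiableAt (by simp))
  have h3 := hasFDerivAt_differential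
    ((contMDiffAt_affineHomeo_comp hΦ hc).mdifferentiableAt (by simp))
  have h4 : HasFDerivAt (chartMetric ε r c) (fderiv ℝ (chartMetric ε r c) (affineHomeo ε c (Φ p)))
      (((fun p' => affineHomeo ε c (Φ p')) ∘ (extChartAt (𝓡 3) p).symm)
        (extChartAt (𝓡 3) p p)) := by
    rw [Function.comp_apply, hx]
    exact ((contDiffAt_chartMetric ε r c hadm).differentiableAt (by simp)).hasFDerivAt
  have h5 := h4.comp _ h3
  have h5' := h5.clm_apply h2
  have h5'' := h5'.clm_apply h2
  -- Differentiate `⟨ξ, ξ⟩ = 1`.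
  have h6 : (fun y => chartMetric ε r c
      (((fun p' => affineHomeo ε c (Φ p')) ∘ (extChartAt (𝓡 3) p).symm) y)
      ((vecInChart c Φ ξ ∘ (extChartAt (𝓡 3) p).symm) y)
      ((vecInChart c Φ ξ ∘ (extChartAt (𝓡 3) p).symm) y)) =ᶠ[𝓝 (extChartAt (𝓡 3) p p)]
      fun _ => (1 : ℝ) := by
    have hcont : Tendsto (extChartAt (𝓡 3) p).symm (𝓝 (extChartAt (𝓡 3) p p)) (𝓝 p) := by
      have := continuousAt_extChartAt_symm (I := 𝓡 3) p
      rwa [ContinuousAt, hx] at this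
    refine hcont.eventually (p := fun p' => chartMetric ε r c (affineHomeo ε c (Φ p'))
      (vecInChart c Φ ξ p') (vecInChart c Φ ξ p') = 1) ?_
    filter_upwards [eventually_mem_source hΦ.continuousAt hc, hξ.1.mem_nhds hp] with p' h1 h2
    exact (spaceFormMetric_eq r h1 _ _).symm.trans (hξ.2.2 p' h2).1
  have h7 := congrArg (fun T => T v)
    ((h5''.congr_of_eventuallyEq h6.symm).unique (hasFDerivAt_const (1 : ℝ) _))
  simp only [ContinuousLinearMap.comp_apply, add_apply, ContinuousLinearMap.flip_apply,
    Function.comp_apply, hx, zero_apply] at h7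
  rw [fderiv_chartMetric hadm] at h7
  rw [map_add, christoffel_chartMetric hr hadm]
  rw [chartMetric_symm _ _ _ _ (chartChristoffel _ _ _ _ _),
    chartMetric_symm _ _ _ _ (differential _ _ _)] at h7
  linarith

/-- `dΦ(A v) = -∇_v ξ`. -/
lemma IsUnitNormalOn.differential_shapeOp (hr : 0 < r) (hξ : IsUnitNormalOn ε r Φ ξ U)
    (hp : p ∈ U) (hinj : Function.Injective
      (differential (E := EuclideanSpace ℝ (Fin 3)) (E' := Fin 2 → ℂ) Φ p))
    (v : EuclideanSpace ℝ (Fin 3)) :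
    differential (E := EuclideanSpace ℝ (Fin 3)) (E' := Fin 2 → ℂ) Φ p
      (shapeOp r Φ ξ p v) = - covDeriv r Φ ξ p v := by
  have h : metricAt r (Φ p) (normalAt ξ p) (-covDeriv r Φ ξ p v) = 0 := by
    rw [map_neg, hξ.metricAt_covDeriv hr hp, neg_zero]
  exact differential_tangentPreimage (hξ.exists_differential_eq hp hinj h)

/-- The covariant derivative as a linear map. -/
lemma exists_covDeriv_linear (r : ℝ) (hΦ : ContinuousAt Φ p)
    (ξ : ∀ p, TangentSpace 𝓘(ℝ, Fin 2 → ℂ) (Φ p)) :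
    ∃ D : EuclideanSpace ℝ (Fin 3) →L[ℝ] (Fin 2 → ℂ), ∀ v, covDeriv r Φ ξ p v = D v := by
  refine ⟨differential (vecInChart (chartIndex (Φ p)) Φ ξ) p
    + (christoffelCLM (chartMetric ε r (chartIndex (Φ p)))
      (affineHomeo ε (chartIndex (Φ p)) (Φ p))).flip (vecInChart (chartIndex (Φ p)) Φ ξ p)
        ∘L differential Φ p, fun v => ?_⟩
  rw [covDeriv_chartIndex r hΦ ξ v]
  simp [christoffelCLM_apply]

/-- A unit normal field is unique up to sign, at each point. -/
lemma IsUnitNormalOn.eq_or_eq_neg (hr : 0 < r) (hξ : IsUnitNormalOn ε r Φ ξ U)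
    (hξ' : IsUnitNormalOn ε r Φ ξ' U') (hp : p ∈ U) (hp' : p ∈ U') (hinj : Function.Injective
      (differential (E := EuclideanSpace ℝ (Fin 3)) (E' := Fin 2 → ℂ) Φ p)) :
    normalAt ξ' p = normalAt ξ p ∨ normalAt ξ' p = - normalAt ξ p := by
  set n := normalAt ξ p
  set n' := normalAt ξ' p
  set g := metricAt r (Φ p) with hg
  have hnn : g n n = 1 := hξ.metricAt_self hp
  have hnn' : g n' n' = 1 := hξ'.metricAt_self hp'
  have horth : g n (n' - g n n' • n) = 0 := by simp [hnn]
  obtain ⟨v, hv⟩ := hξ.exists_differential_eq hp hinj horth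
  have hself : g (n' - g n n' • n) (n' - g n n' • n) = 0 := by
    have h1 : g n (differential Φ p v) = 0 := hξ.metricAt_differential hp v
    have h2 : g n' (differential Φ p v) = 0 := hξ'.metricAt_differential hp' v
    rw [map_sub g, map_smul g, sub_apply, smul_apply, ← hv, h1, h2]
    simp
  have hzero : n' - g n n' • n = 0 := by
    by_contra hne
    exact (metricAt_pos hr (Φ p) hne).ne' hself
  have hn' : n' = g n n' • n := sub_eq_zero.1 hzero
  have hsq : g n n' * g n n' = 1 := by
    rw [hn'] at hnn'
    simpa [hnn] using hnn'
  rcases mul_self_eq_one_iff.1 hsq with h | h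
  · left; rw [hn', h, one_smul]
  · right; rw [hn', h, neg_one_smul]

lemma IsUnitNormalOn.normalAt_ne_zero (hξ : IsUnitNormalOn ε r Φ ξ U) (hp : p ∈ U) :
    normalAt ξ p ≠ 0 := by
  intro h
  have := hξ.metricAt_self hp
  rw [h] at this
  simp at this

/-- A unit normal field is unique up to sign, near each point. -/
lemma IsUnitNormalOn.eventually_eq_smul (hr : 0 < r)
    (hΦ : IsSmoothImmersion (E := EuclideanSpace ℝ (Fin 3)) (E' := Fin 2 → ℂ) Φ)
    (hξ : IsUnitNormalOn ε r Φ ξ U) (hξ' : IsUnitNormalOn ε r Φ ξ' U') (hp : p ∈ U)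
    (hp' : p ∈ U') :
    ∃ σ : ℝ, ∀ᶠ q in 𝓝 p, normalAt ξ' q = σ • normalAt ξ q := by
  have hc := mem_source_chartIndex (Φ p)
  have hcont := (contMDiffAt_vecInChart (hξ.contMDiffAt hp) hc).continuousAt
  have hcont' := (contMDiffAt_vecInChart (hξ'.contMDiffAt hp') hc).continuousAt
  have hpt : ∀ᶠ q in 𝓝 p, normalAt ξ' q = normalAt ξ q ∨ normalAt ξ' q = - normalAt ξ q := by
    filter_upwards [hξ.1.mem_nhds hp, hξ'.1.mem_nhds hp'] with q h1 h2
    exact hξ.eq_or_eq_neg hr hξ' h1 h2 (hΦ.2 q)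
  have hn0 := hξ.normalAt_ne_zero hp
  -- The sign at `p` persists nearby, as `ξ' + ξ` or `ξ' - ξ` stays away from zero.
  rcases hpt.self_of_nhds with h | h
  · refine ⟨1, ?_⟩
    have hne : vecInChart (chartIndex (Φ p)) Φ ξ' p + vecInChart (chartIndex (Φ p)) Φ ξ p ≠ 0 := by
      rw [vecInChart_eq_normalAt, vecInChart_eq_normalAt, h, ← two_smul ℝ]
      exact smul_ne_zero two_ne_zero hn0
    filter_upwards [hpt, (hcont'.add hcont).eventually_ne hne] with q h1 h2
    rw [one_smul]
    refine h1.resolve_right fun h3 => h2 ?_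
    change chartDeriv _ _ (normalAt ξ' q) + chartDeriv _ _ (normalAt ξ q) = 0
    rw [h3, map_neg, neg_add_cancel]
  · refine ⟨-1, ?_⟩
    have hne : vecInChart (chartIndex (Φ p)) Φ ξ' p - vecInChart (chartIndex (Φ p)) Φ ξ p ≠ 0 := by
      rw [vecInChart_eq_normalAt, vecInChart_eq_normalAt, h, ← neg_add', neg_ne_zero, ← two_smul ℝ]
      exact smul_ne_zero two_ne_zero hn0
    filter_upwards [hpt, (hcont'.sub hcont).eventually_ne hne] with q h1 h2
    rw [neg_one_smul]
    refine h1.resolve_left fun h3 => h2 ?_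
    change chartDeriv _ _ (normalAt ξ' q) - chartDeriv _ _ (normalAt ξ q) = 0
    rw [h3, sub_self]

/-- Rescaling the field near `p` by a constant rescales its covariant derivative at `p`. -/
lemma covDeriv_smul_of_eventually {σ : ℝ}
    (hξ : ContMDiffAt (𝓡 3) 𝓘(ℝ, Fin 2 → ℂ).tangent ∞
      (fun p => (⟨Φ p, ξ p⟩ : TangentBundle 𝓘(ℝ, Fin 2 → ℂ) (SpaceForm ε))) p)
    (h : ∀ᶠ q in 𝓝 p, normalAt ξ' q = σ • normalAt ξ q) (v : EuclideanSpace ℝ (Fin 3)) :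
    covDeriv r Φ ξ' p v = σ • covDeriv r Φ ξ p v := by
  have hΦ : ContMDiffAt (𝓡 3) 𝓘(ℝ, Fin 2 → ℂ) ∞ Φ p :=
    (Bundle.contMDiffAt_totalSpace.1 hξ).1
  have hc := mem_source_chartIndex (Φ p)
  have h1 : vecInChart (chartIndex (Φ p)) Φ ξ' =ᶠ[𝓝 p]
      fun q => σ • vecInChart (chartIndex (Φ p)) Φ ξ q := by
    filter_upwards [h] with q hq
    change chartDeriv _ _ (normalAt ξ' q) = σ • chartDeriv _ _ (normalAt ξ q)
    rw [hq, map_smul]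
  have h2 : differential (E := EuclideanSpace ℝ (Fin 3)) (E' := Fin 2 → ℂ)
        (vecInChart (chartIndex (Φ p)) Φ ξ') p =
      σ • differential (E := EuclideanSpace ℝ (Fin 3)) (E' := Fin 2 → ℂ)
        (vecInChart (chartIndex (Φ p)) Φ ξ) p := by
    have h3 : differential (E := EuclideanSpace ℝ (Fin 3)) (E' := Fin 2 → ℂ)
        (vecInChart (chartIndex (Φ p)) Φ ξ') p =
        differential (E := EuclideanSpace ℝ (Fin 3)) (E' := Fin 2 → ℂ)
          (fun q => σ • vecInChart (chartIndex (Φ p)) Φ ξ q) p :=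
      Filter.EventuallyEq.mfderiv_eq (I := 𝓡 3) (I' := 𝓘(ℝ, Fin 2 → ℂ)) h1
    have hd : MDifferentiableAt (𝓡 3) 𝓘(ℝ, Fin 2 → ℂ) (vecInChart (chartIndex (Φ p)) Φ ξ) p :=
      (contMDiffAt_vecInChart hξ hc).mdifferentiableAt (by simp)
    rw [h3]
    exact const_smul_mfderiv (I := 𝓡 3) hd σ
  rw [covDeriv_chartIndex r hΦ.continuousAt, covDeriv_chartIndex r hΦ.continuousAt, h2,
    h1.self_of_nhds]
  simp only [← christoffelCLM_apply, map_smul, smul_apply, smul_add]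

/-- The shape operator as a linear map. -/
lemma IsUnitNormalOn.exists_shapeOp_linear (hr : 0 < r) (hξ : IsUnitNormalOn ε r Φ ξ U)
    (hp : p ∈ U) (hinj : Function.Injective
      (differential (E := EuclideanSpace ℝ (Fin 3)) (E' := Fin 2 → ℂ) Φ p)) :
    ∃ A : EuclideanSpace ℝ (Fin 3) →ₗ[ℝ] EuclideanSpace ℝ (Fin 3),
      shapeOp r Φ ξ p = A := by
  have hΦ : ContMDiffAt (𝓡 3) 𝓘(ℝ, Fin 2 → ℂ) ∞ Φ p :=
    (Bundle.contMDiffAt_totalSpace.1 (hξ.contMDiffAt hp)).1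
  obtain ⟨D, hD⟩ := exists_covDeriv_linear r hΦ.continuousAt ξ
  have key := hξ.differential_shapeOp hr hp hinj
  refine ⟨{ toFun := shapeOp r Φ ξ p, map_add' := fun a b => ?_,
            map_smul' := fun t a => ?_ }, rfl⟩
  · apply hinj
    rw [map_add, key, key, key, hD, hD, hD, map_add, neg_add]
  · apply hinj
    rw [map_smul, key, key, hD, hD, map_smul, smul_neg]
    rfl

/-- The distribution `ℋ` can be computed from any local unit normal field. -/
theorem IsUnitNormalOn.hopfSpace_eq (hr : 0 < r)
    (hΦ : IsSmoothImmersion (E := EuclideanSpace ℝ (Fin 3)) (E' := Fin 2 → ℂ) Φ)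
    (hξ : IsUnitNormalOn ε r Φ ξ U) (hp : p ∈ U) :
    hopfSpace r Φ p = Submodule.span ℝ (Set.range fun k : ℕ =>
      (shapeOp r Φ ξ p)^[k] (structVec Φ ξ p)) := by
  apply le_antisymm
  · refine iSup_le fun ξ' => iSup_le fun U' => iSup_le fun h => ?_
    obtain ⟨hξ', hp'⟩ := h
    obtain ⟨σ, hσ⟩ := hξ.eventually_eq_smul hr hΦ hξ' hp hp'
    have hinj : Function.Injective
      (differential (E := EuclideanSpace ℝ (Fin 3)) (E' := Fin 2 → ℂ) Φ p) := hΦ.2 p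
    obtain ⟨A, hA⟩ := hξ.exists_shapeOp_linear hr hp hinj
    have hA' : ∀ v, shapeOp r Φ ξ' p v = σ • A v := by
      intro v
      apply hinj
      rw [hξ'.differential_shapeOp hr hp' hinj, covDeriv_smul_of_eventually (hξ.contMDiffAt hp) hσ,
        ← smul_neg, ← hξ.differential_shapeOp hr hp hinj, hA, ← map_smul]
    have hW' : structVec Φ ξ' p = σ • structVec Φ ξ p := by
      apply hinj
      rw [hξ'.differential_structVec hp' hinj, hσ.self_of_nhds, smul_comm, ← smul_neg,
        ← hξ.differential_structVec hp hinj, map_smul]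
    have hiter : ∀ k : ℕ, ∃ t : ℝ, (shapeOp r Φ ξ' p)^[k] (structVec Φ ξ' p) =
        t • (shapeOp r Φ ξ p)^[k] (structVec Φ ξ p) := by
      intro k
      induction k with
      | zero => exact ⟨σ, hW'⟩
      | succ k ih =>
        obtain ⟨t, ht⟩ := ih
        refine ⟨σ * t, ?_⟩
        rw [Function.iterate_succ_apply', Function.iterate_succ_apply', ht, hA', hA, map_smul,
          mul_smul]
    have hle : Submodule.span ℝ (Set.range fun k : ℕ =>
        (shapeOp r Φ ξ' p)^[k] (structVec Φ ξ' p)) ≤ Submodule.span ℝ (Set.range fun k : ℕ =>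
        (shapeOp r Φ ξ p)^[k] (structVec Φ ξ p)) := by
      rw [Submodule.span_le]
      rintro _ ⟨k, rfl⟩
      obtain ⟨t, ht⟩ := hiter k
      simp only [ht]
      exact Submodule.smul_mem _ _ (Submodule.subset_span ⟨k, rfl⟩)
    exact hle
  · exact le_iSup_of_le ξ (le_iSup_of_le U (le_iSup_of_le ⟨hξ, hp⟩ le_rfl))

lemma IsUnitNormalOn.structVec_mem (hr : 0 < r)
    (hΦ : IsSmoothImmersion (E := EuclideanSpace ℝ (Fin 3)) (E' := Fin 2 → ℂ) Φ)
    (hξ : IsUnitNormalOn ε r Φ ξ U) (hp : p ∈ U) : structVec Φ ξ p ∈ hopfSpace r Φ p := by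
  rw [hξ.hopfSpace_eq hr hΦ hp]
  exact Submodule.subset_span ⟨0, rfl⟩

/-- The distribution `ℋ` is invariant under the shape operator. -/
theorem IsUnitNormalOn.shapeOp_mem (hr : 0 < r)
    (hΦ : IsSmoothImmersion (E := EuclideanSpace ℝ (Fin 3)) (E' := Fin 2 → ℂ) Φ)
    (hξ : IsUnitNormalOn ε r Φ ξ U) (hp : p ∈ U) {v : EuclideanSpace ℝ (Fin 3)}
    (hv : v ∈ hopfSpace r Φ p) : shapeOp r Φ ξ p v ∈ hopfSpace r Φ p := by
  rw [hξ.hopfSpace_eq hr hΦ hp] at hv ⊢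
  obtain ⟨A, hA⟩ := hξ.exists_shapeOp_linear hr hp (hΦ.2 p)
  induction hv using Submodule.span_induction with
  | mem x hx =>
    obtain ⟨k, rfl⟩ := hx
    exact Submodule.subset_span ⟨k + 1, Function.iterate_succ_apply' _ _ _⟩
  | zero =>
    rw [hA, map_zero]
    exact Submodule.zero_mem _
  | add x y _ _ hx hy =>
    rw [hA, map_add, ← hA]
    exact Submodule.add_mem _ hx hy
  | smul t x _ hx =>
    rw [hA, map_smul, ← hA]
    exact Submodule.smul_mem _ _ hx

end UnitNormals

/-! ### The leaves of `ℋ` -/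

section Leaves

variable {ε : ℤˣ} {r : ℝ}
  {M : Type*} [TopologicalSpace M] [ChartedSpace (EuclideanSpace ℝ (Fin 3)) M]
  {S : Type*} [TopologicalSpace S] [ChartedSpace (EuclideanSpace ℝ (Fin 2)) S]

/-- Where `ℋ` is not zero, there is a local unit normal field. -/
lemma exists_isUnitNormalOn {Φ : M → SpaceForm ε} {p : M}
    (h : Module.finrank ℝ (hopfDistribution ε r Φ p) = 2) :
    ∃ (ξ : ∀ p, TangentSpace 𝓘(ℝ, Fin 2 → ℂ) (Φ p)) (U : Set M),
      IsUnitNormalOn ε r Φ ξ U ∧ p ∈ U := by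
  by_contra hne
  push Not at hne
  have hbot : hopfDistribution ε r Φ p = ⊥ := by
    rw [hopfDistribution]
    refine le_bot_iff.1 (iSup_le fun ξ => iSup_le fun U => iSup_le fun hU => ?_)
    exact absurd hU.2 (hne ξ U hU.1)
  rw [hbot, finrank_bot] at h
  exact absurd h (by norm_num)

lemma bijective_differential_extChartAt_symm [IsManifold (𝓡 2) ∞ S] (s : S)
    {y : EuclideanSpace ℝ (Fin 2)} (hy : y ∈ (extChartAt (𝓡 2) s).target) :
    Function.Bijective (differential (E := EuclideanSpace ℝ (Fin 2))
      (E' := EuclideanSpace ℝ (Fin 2)) (extChartAt (𝓡 2) s).symm y) := by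
  have : IsManifold (𝓡 2) 1 S := IsManifold.of_le (n := ∞) (by simp)
  have h := isInvertible_mfderivWithin_extChartAt_symm (I := 𝓡 2) hy
  rw [modelWithCornersSelf_coe, Set.range_id, mfderivWithin_univ] at h
  exact h.bijective

lemma differential_comp {E E' E'' : Type*} [NormedAddCommGroup E] [NormedSpace ℝ E]
    [NormedAddCommGroup E'] [NormedSpace ℝ E'] [NormedAddCommGroup E''] [NormedSpace ℝ E'']
    {X Y Z : Type*} [TopologicalSpace X] [ChartedSpace E X] [TopologicalSpace Y]
    [ChartedSpace E' Y] [TopologicalSpace Z] [ChartedSpace E'' Z] {g : Y → Z} {f : X → Y} {x : X}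
    (hg : MDifferentiableAt 𝓘(ℝ, E') 𝓘(ℝ, E'') g (f x))
    (hf : MDifferentiableAt 𝓘(ℝ, E) 𝓘(ℝ, E') f x) (v : E) :
    differential (E := E) (E' := E'') (g ∘ f) x v =
      differential (E := E') (E' := E'') g (f x) (differential (E := E) (E' := E') f x v) :=
  congrArg (fun T => T v) (mfderiv_comp x hg hf)

lemma differential_eq_fderiv {E E' : Type*} [NormedAddCommGroup E] [NormedSpace ℝ E]
    [NormedAddCommGroup E'] [NormedSpace ℝ E'] (f : E → E') (x : E) :
    differential (E := E) (E' := E') f x = fderiv ℝ f x := mfderiv_eq_fderiv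

/-- The numerator of the Gauss curvature of a leaf vanishes. -/
theorem curvature_leaf [IsManifold (𝓡 2) ∞ S] (hr : 0 < r) {Φ : M → SpaceForm ε}
    (hΦ : IsKHopf ε r 2 Φ) {j : S → M}
    (hj : IsIntegralManifold (E := EuclideanSpace ℝ (Fin 2)) (hopfDistribution ε r Φ) j) (s : S)
    (u v a b : EuclideanSpace ℝ (Fin 2)) :
    metricInChart (pullbackMetric (Φ ∘ j) (spaceFormMetric ε r)) s (extChartAt (𝓡 2) s s)
      (curvature (metricInChart (pullbackMetric (Φ ∘ j) (spaceFormMetric ε r)) s)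
        (extChartAt (𝓡 2) s s) u v a) b = 0 := by
  obtain ⟨ξ, U, hξ, hsU⟩ := exists_isUnitNormalOn (hΦ.2.1 (j s))
  have him := hΦ.1
  let i := chartIndex (Φ (j s))
  let q : EuclideanSpace ℝ (Fin 2) → S := fun y => (extChartAt (𝓡 2) s).symm y
  have hjc : Continuous j := hj.1.1.continuous
  have hΦc : Continuous Φ := him.1.continuous
  let V : Set (EuclideanSpace ℝ (Fin 2)) := (extChartAt (𝓡 2) s).target ∩
    q ⁻¹' {s' | j s' ∈ U ∧ Φ (j s') ∈ (affineHomeo ε i).source}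
  have hV : IsOpen V := by
    refine (continuousOn_extChartAt_symm s).isOpen_inter_preimage (isOpen_extChartAt_target s) ?_
    exact (hξ.1.preimage hjc).inter ((affineHomeo ε i).open_source.preimage (hΦc.comp hjc))
  have hyU : ∀ y ∈ V, (j ∘ q) y ∈ U := fun y hy => hy.2.1
  have hyS : ∀ y ∈ V, Φ ((j ∘ q) y) ∈ (affineHomeo ε i).source := fun y hy => hy.2.2
  have hqs : ∀ y ∈ V, ContMDiffAt (𝓡 2) (𝓡 2) ∞ q y := fun y hy =>
    (contMDiffOn_extChartAt_symm s).contMDiffAt ((isOpen_extChartAt_target s).mem_nhds hy.1)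
  have hjq : ∀ y ∈ V, ContMDiffAt (𝓡 2) (𝓡 3) ∞ (j ∘ q) y := fun y hy =>
    (hj.1.1 (q y)).comp y (hqs y hy)
  have hjqd : ∀ y ∈ V, MDifferentiableAt (𝓡 2) (𝓡 3) (j ∘ q) y := fun y hy =>
    (hjq y hy).mdifferentiableAt (by simp)
  -- the leaf and the unit normal field, in the chart of the space form at the given point
  let F : EuclideanSpace ℝ (Fin 2) → Fin 2 → ℂ := (fun p => affineHomeo ε i (Φ p)) ∘ (j ∘ q)
  let N : EuclideanSpace ℝ (Fin 2) → Fin 2 → ℂ := vecInChart i Φ ξ ∘ (j ∘ q)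
  have hΦs : ∀ y ∈ V, ContMDiffAt (𝓡 3) 𝓘(ℝ, Fin 2 → ℂ) ∞ (fun p => affineHomeo ε i (Φ p))
      ((j ∘ q) y) := fun y hy => contMDiffAt_affineHomeo_comp (him.1 _) (hyS y hy)
  have hξs : ∀ y ∈ V, ContMDiffAt (𝓡 3) 𝓘(ℝ, Fin 2 → ℂ) ∞ (vecInChart i Φ ξ) ((j ∘ q) y) :=
    fun y hy => contMDiffAt_vecInChart (hξ.contMDiffAt (hyU y hy)) (hyS y hy)
  have hΦd : ∀ p, MDifferentiableAt (𝓡 3) 𝓘(ℝ, Fin 2 → ℂ) Φ p := fun p =>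
    (him.1 p).mdifferentiableAt (by simp)
  have hjd : ∀ s', MDifferentiableAt (𝓡 2) (𝓡 3) j s' := fun s' =>
    (hj.1.1 s').mdifferentiableAt (by simp)
  have hDF : ∀ y ∈ V, ∀ u, fderiv ℝ F y u = chartDeriv i (Φ ((j ∘ q) y))
      (differential (E := EuclideanSpace ℝ (Fin 3)) (E' := Fin 2 → ℂ) Φ ((j ∘ q) y)
        (differential (E := EuclideanSpace ℝ (Fin 2)) (E' := EuclideanSpace ℝ (Fin 3)) (j ∘ q) y u)) := by
    intro y hy u
    rw [← differential_eq_fderiv]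
    refine (differential_comp ((hΦs y hy).mdifferentiableAt (by simp)) (hjqd y hy) u).trans ?_
    exact differential_affineHomeo_comp (hΦd _) (hyS y hy) _
  have hDN : ∀ y ∈ V, ∀ u, fderiv ℝ N y u =
      differential (E := EuclideanSpace ℝ (Fin 3)) (E' := Fin 2 → ℂ) (vecInChart i Φ ξ) ((j ∘ q) y)
        (differential (E := EuclideanSpace ℝ (Fin 2)) (E' := EuclideanSpace ℝ (Fin 3))
          (j ∘ q) y u) := by
    intro y hy u
    rw [← differential_eq_fderiv]
    exact differential_comp ((hξs y hy).mdifferentiableAt (by simp)) (hjqd y hy) u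
  have hdjq : ∀ y ∈ V, ∀ u,
      differential (E := EuclideanSpace ℝ (Fin 2)) (E' := EuclideanSpace ℝ (Fin 3)) (j ∘ q) y u =
      differential (E := EuclideanSpace ℝ (Fin 2)) (E' := EuclideanSpace ℝ (Fin 3)) j (q y)
        (differential (E := EuclideanSpace ℝ (Fin 2)) (E' := EuclideanSpace ℝ (Fin 2)) q y u) :=
    fun y hy u =>
    differential_comp (hjd _) ((hqs y hy).mdifferentiableAt (by simp)) u
  have hqb : ∀ y ∈ V, Function.Bijective (differential (E := EuclideanSpace ℝ (Fin 2))
      (E' := EuclideanSpace ℝ (Fin 2)) q y) := fun y hy =>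
    bijective_differential_extChartAt_symm s hy.1
  -- the tangent planes of the leaf are those of `ℋ`
  have hmem : ∀ y ∈ V, ∀ x : EuclideanSpace ℝ (Fin 3), x ∈ hopfSpace r Φ ((j ∘ q) y) ↔
      ∃ w, differential (E := EuclideanSpace ℝ (Fin 2)) (E' := EuclideanSpace ℝ (Fin 3))
        (j ∘ q) y w = x := by
    intro y hy x
    have h1 : x ∈ hopfSpace r Φ ((j ∘ q) y) ↔
        ∃ w, differential (E := EuclideanSpace ℝ (Fin 2)) (E' := EuclideanSpace ℝ (Fin 3))
          j (q y) w = x := by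
      have h2 := SetLike.ext_iff.1 (hj.2 (q y)) x
      exact h2.symm
    rw [h1]
    constructor
    · rintro ⟨w, hw⟩
      obtain ⟨w', rfl⟩ := (hqb y hy).2 w
      exact ⟨w', (hdjq y hy w').trans hw⟩
    · rintro ⟨w, hw⟩
      exact ⟨_, (hdjq y hy w).symm.trans hw⟩
  have hinjΦ : ∀ p, Function.Injective (differential (E := EuclideanSpace ℝ (Fin 3))
      (E' := Fin 2 → ℂ) Φ p) := him.2
  have hinjj : ∀ s', Function.Injective (differential (E := EuclideanSpace ℝ (Fin 2))
      (E' := EuclideanSpace ℝ (Fin 3)) j s') := hj.1.2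
  have hs : extChartAt (𝓡 2) s s ∈ V := by
    refine ⟨mem_extChartAt_target s, ?_⟩
    have hqs : q (extChartAt (𝓡 2) s s) = s := extChartAt_to_inv s
    change j (q _) ∈ U ∧ Φ (j (q _)) ∈ _
    rw [hqs]
    exact ⟨hsU, mem_source_chartIndex _⟩
  have hadm : ∀ y ∈ V, IsAdmissible ε (homog i 1 (F y)) := fun y hy =>
    isAdmissible_affineHomeo (hyS y hy)
  have hNy : ∀ y, N y = chartDeriv i (Φ ((j ∘ q) y)) (normalAt ξ ((j ∘ q) y)) := fun y => rfl
  refine pullback_flat_of_normal (J := Complex.I • ContinuousLinearMap.id ℝ (Fin 2 → ℂ))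
    (F := F) (N := N) (G' := chartMetric ε r i) hV ?_ ?_ ?_ ?_ ?_ ?_ ?_ ?_ ?_ ?_ ?_ ?_ ?_ ?_ ?_ hs
    u v a b
  · intro a
    change Complex.I • Complex.I • a = -a
    rw [smul_smul, Complex.I_mul_I, neg_one_smul]
  · exact fun y hy => ((hΦs y hy).comp y (hjq y hy)).contDiffAt
  · exact fun y hy => ((hξs y hy).comp y (hjq y hy)).contDiffAt
  · exact fun y hy => contDiffAt_chartMetric ε r i (hadm y hy)
  · exact fun y hy => chartMetric_symm ε r i (F y)
  · exact fun y hy a ha => chartMetric_pos hr (hadm y hy) ha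
  · exact fun y hy => isInvertible_chartMetric hr (hadm y hy)
  · exact fun y hy a b => chartMetric_I_skew ε r i (F y) a b
  · exact fun y hy a b => christoffel_chartMetric_I hr (hadm y hy) a b
  · intro y hy u v
    rw [hDF y hy, hDF y hy, hdjq y hy, hdjq y hy]
    have hf : ∀ w, differential (E := EuclideanSpace ℝ (Fin 2)) (E' := Fin 2 → ℂ) (Φ ∘ j) (q y) w =
        differential (E := EuclideanSpace ℝ (Fin 3)) (E' := Fin 2 → ℂ) Φ ((j ∘ q) y)
          (differential (E := EuclideanSpace ℝ (Fin 2)) (E' := EuclideanSpace ℝ (Fin 3)) j (q y) w) :=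
      fun w => differential_comp (hΦd _) (hjd _) w
    rw [← hf, ← hf]
    exact spaceFormMetric_eq r (hyS y hy) _ _
  · intro y hy u v huv
    rw [hDF y hy, hDF y hy, hdjq y hy, hdjq y hy] at huv
    exact (hqb y hy).1 (hinjj _ (hinjΦ _ (chartDeriv_injective (hyS y hy) huv)))
  · intro y hy h0
    refine hξ.normalAt_ne_zero (hyU y hy) (chartDeriv_injective (hyS y hy) ?_)
    rw [map_zero]
    exact h0
  · intro y hy u
    rw [hDF y hy, hNy]
    exact (spaceFormMetric_eq r (hyS y hy) _ _).symm.trans (hξ.metricAt_differential (hyU y hy) _)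
  · intro y hy
    obtain ⟨w, hw⟩ := (hmem y hy _).1 (hξ.structVec_mem hr him (hyU y hy))
    refine ⟨-w, ?_⟩
    rw [map_neg, hDF y hy, hw, hξ.differential_structVec (hyU y hy) (hinjΦ _), map_neg, neg_neg,
      chartDeriv_I (hyS y hy)]
    rfl
  · intro y hy u
    obtain ⟨c, hc⟩ := (hmem y hy _).1 (hξ.shapeOp_mem hr him (hyU y hy) ((hmem y hy _).2 ⟨u, rfl⟩))
    refine ⟨-c, ?_⟩
    rw [map_neg, hDF y hy, hc, hξ.differential_shapeOp hr (hyU y hy) (hinjΦ _), map_neg, neg_neg,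
      chartDeriv_covDeriv hr (hξ.contMDiffAt (hyU y hy)) (hyS y hy), hDN y hy, hDF y hy,
      differential_affineHomeo_comp (hΦd _) (hyS y hy)]
    rfl

end Leaves

end TwoHopf

theorem mainTheorem7 (ε : ℤˣ) (r : ℝ) (hr : 0 < r)
    {M : Type*} [TopologicalSpace M] [ChartedSpace (EuclideanSpace ℝ (Fin 3)) M]
    [IsManifold (𝓡 3) ∞ M]
    (Φ : M → TwoHopf.SpaceForm ε) (hΦ : TwoHopf.IsKHopf ε r 2 Φ)
    {S : Type*} [TopologicalSpace S] [ChartedSpace (EuclideanSpace ℝ (Fin 2)) S]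
    [IsManifold (𝓡 2) ∞ S]
    (j : S → M)
    (hj : TwoHopf.IsIntegralManifold (E := EuclideanSpace ℝ (Fin 2))
      (TwoHopf.hopfDistribution ε r Φ) j)
    (s : S) :
    TwoHopf.gaussCurvature
      (TwoHopf.pullbackMetric (Φ ∘ j) (TwoHopf.spaceFormMetric ε r)) s = 0 := by
  simp only [TwoHopf.gaussCurvature]
  rw [TwoHopf.curvature_leaf hr hΦ hj s, zero_div]
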